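/- Let $f\in\mathbb R\setminus\mathbb Z$ and let $R_f(\mathbb R,\mathbb Z)$ be the convex hull of all finitely supported functions $y\colon\mathbb R\to\mathbb Z_{\ge 0}$ with $\sum_{r\in\mathbb R} r\,y(r)\in f+\mathbb Z$. A function $\pi\colon\mathbb R\to\mathbb R$ with $\pi\ge 0$ is *valid* for $R_f(\mathbb R,\mathbb Z)$ if $\sum_{r}\pi(r)y(r)\ge 1$ for all $y\in R_f(\mathbb R,\mathbb Z)$; a valid function $\pi$ is *extreme* if $\pi=\tfrac12(\pi^1+\pi^2)$ with $\pi^1,\pi^2$ valid implies $\pi=\pi^1=\pi^2$. A function $\pi\colon\mathbb R\to\mathbb R$ is *piecewise linear* if there is a locally finite set $B\subset\mathbb R$ of breakpoints such that $\pi$ is affine on every open interval disjoint from $B$ (no condition is imposed on the values at the breakpoints, so $\pi$ may be discontinuous), and *continuous piecewise linear* if, for some such $B$, $\pi$ is moreover affine on the closure of every such interval. The *slopes* of $\pi$ are the different values that its derivative takes, at the points where it exists. 1. For each $s\in\{5,6,7,28\}$ there exist $f\in\mathbb R\setminus\mathbb Z$ and a continuous piecewise linear extreme function for $R_f(\mathbb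 R,\mathbb Z)$ with exactly $s$ slopes. 2. There exist $f\in\mathbb R\setminus\mathbb Z$ and a discontinuous piecewise linear extreme function for $R_f(\mathbb R,\mathbb Z)$ with exactly $3$ slopes. 3. There exist $f\in\mathbb R\setminus\mathbb Z$ and a piecewise linear extreme function $\pi$ for $R_f(\mathbb R,\mathbb Z)$ that is discontinuous on both sides at the origin, that is, neither left-continuous nor right-continuous at $0$. -/

import Mathlib

namespace GroupProblem

/-- The feasible set of the group problem: the finitely supported functions `y : G → ℝ` with
nonnegative integer values such that `∑ r, y r • r` lies in the coset `f + S`. -/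
def feasible {G : Type*} [AddCommGroup G] (f : G) (S : AddSubgroup G) : Set (G →₀ ℝ) :=
  {y | ∃ n : G →₀ ℕ, (∀ r, y r = (n r : ℝ)) ∧ (n.sum fun r k => k • r) - f ∈ S}

/-- `R_f(G,S)`, the convex hull of the feasible set in `ℝ^(G)`. -/
def R {G : Type*} [AddCommGroup G] (f : G) (S : AddSubgroup G) : Set (G →₀ ℝ) :=
  convexHull ℝ (feasible f S)

/-- A valid function: `π ≥ 0` and `∑ r, π r * y r ≥ 1` for every `y ∈ R_f(G,S)`. -/
def IsValid {G : Type*} [AddCommGroup G] (f : G) (S : AddSubgroup G) (π : G → ℝ) : Prop :=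
  (∀ r, 0 ≤ π r) ∧ ∀ y ∈ R f S, 1 ≤ y.sum fun r c => π r * c

/-- An extreme function: a valid function which is not a proper convex combination of two other
valid functions. -/
def IsExtreme {G : Type*} [AddCommGroup G] (f : G) (S : AddSubgroup G) (π : G → ℝ) : Prop :=
  IsValid f S π ∧ ∀ π₁ π₂ : G → ℝ, IsValid f S π₁ → IsValid f S π₂ →
    π = (1 / 2 : ℝ) • (π₁ + π₂) → π = π₁ ∧ π = π₂

/-- The subgroup `ℤ` of `ℝ`. -/
def intSubgroup : AddSubgroup ℝ := (Int.castAddHom ℝ).range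

/-- `π` is affine over `U`, with some gradient `c`. -/
def AffineOver (π : ℝ → ℝ) (U : Set ℝ) : Prop :=
  ∃ c : ℝ, ∀ u ∈ U, ∀ v ∈ U, π v - π u = c * (v - u)

/-- A locally finite set of breakpoints. These are precisely the vertex sets of the pure and
complete locally finite polyhedral complexes of `ℝ`; the cells of the complex are the closures of
the connected components of the complement. -/
def LocallyFiniteBreakpoints (B : Set ℝ) : Prop :=
  ∀ a b : ℝ, (B ∩ Set.Icc a b).Finite

/-- Piecewise linear, possibly discontinuous: `π` is affine over the (relative) interior of each
cell. (On the zero-dimensional faces, the breakpoints, this is no condition.) -/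
def IsPiecewiseLinear (π : ℝ → ℝ) : Prop :=
  ∃ B : Set ℝ, LocallyFiniteBreakpoints B ∧
    ∀ a b : ℝ, a < b → Disjoint (Set.Ioo a b) B → AffineOver π (Set.Ioo a b)

/-- Continuous piecewise linear: `π` is affine over each (closed) cell. -/
def IsContinuousPiecewiseLinear (π : ℝ → ℝ) : Prop :=
  ∃ B : Set ℝ, LocallyFiniteBreakpoints B ∧
    ∀ a b : ℝ, a < b → Disjoint (Set.Ioo a b) B → AffineOver π (Set.Icc a b)

/-- The slopes of `π`: the values of the derivative, wherever it exists. -/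
def slopes (π : ℝ → ℝ) : Set ℝ := {c | ∃ x : ℝ, HasDerivAt π c x}

end GroupProblem

open Set Filter Topology

/-! ### Minimal functions: validity and decompositions -/

namespace GroupProblem

/-! All examples use `f = 1/2`. A subadditive, symmetric, periodic function `π` is valid, and if it
is an average of two valid functions, these are again of this kind (`IsMinimal.of_average`) and
satisfy every additivity relation `π (x + y) = π x + π y` (`additive_of_average`). Extremality thus
means that the additivity relations, with normalization and subadditivity, determine `π`.
Boundedness lets Cauchy's equation on an interval force linearity.

For the slope counts, `π` is `-2x` on `[-1/2, 0]` and `K x - 2x` on `[0, 1/4]`, and is completed by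
symmetry. If `K` increases while `K x / x` decreases, `π` is minimal (`IsStair.isMinimal`). The
descending piece is rigid, and combining it with the rest shows that intervals of constancy of `K`
are inherited, as are additivity relations of `K` (`IsStair.isExtreme`). The staircase `zigzag n`
alternates constant pieces with pieces on lines through the origin, of gradients `4, 8, ..., 4 * 2 ^
n` from right to left. Each sloped piece away from the origin contains an interval `[a, 4a]`, long
enough for Cauchy's equation to apply within it. So the value `1` at `1/4` propagates leftwards
through all pieces. Together with gradient `0` this gives `n + 2` slopes. Making `K` constant up to
the origin, with a jump there, keeps rigidity and the slope count (`isExtreme_flatten_zigzag`).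

For a two-sided jump at `0`, the even function `spikes` is used. Additive triples make any component
of it affine on `(0, 1/4)` and `(-1/4, 0)`, leaving two unknown gradients. Two limiting
subadditivity inequalities, tight for `spikes`, determine them (`isExtreme_spikes`). -/

/-- The functional characterization of minimal valid functions for `R_f(ℝ,ℤ)`. -/
structure IsMinimal (f : ℝ) (π : ℝ → ℝ) : Prop where
  nonneg : ∀ x, 0 ≤ π x
  zero : π 0 = 0
  periodic : ∀ x, π (x + 1) = π x
  symm : ∀ x, π x + π (f - x) = 1
  subadd : ∀ x y, π (x + y) ≤ π x + π y

namespace IsMinimal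

variable {f : ℝ} {π : ℝ → ℝ}

lemma le_one (h : IsMinimal f π) (x : ℝ) : π x ≤ 1 := by
  have := h.symm x
  have := h.nonneg (f - x)
  linarith

lemma periodic_int (h : IsMinimal f π) (x : ℝ) (k : ℤ) : π (x + k) = π x := by
  have hp : Function.Periodic π 1 := h.periodic
  simpa using hp.int_mul k x

lemma apply_f (h : IsMinimal f π) : π f = 1 := by
  have := h.symm 0
  rw [h.zero, sub_zero] at this
  linarith

lemma nsmul_le (h : IsMinimal f π) (x : ℝ) (k : ℕ) : π (k • x) ≤ k * π x := by
  induction k with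
  | zero => simp [h.zero]
  | succ k ih =>
    rw [succ_nsmul]
    have := h.subadd (k • x) x
    push_cast
    linarith

end IsMinimal

lemma sum_eq_linearCombination (π : ℝ → ℝ) (y : ℝ →₀ ℝ) :
    (y.sum fun r c => π r * c) = Finsupp.linearCombination ℝ π y := by
  rw [Finsupp.linearCombination_apply]
  simp only [smul_eq_mul, mul_comm]

/-- The inequality is linear in `y`, so only feasible points matter; there subadditivity and
periodicity bound the sum below by `π f = 1`. -/
lemma IsMinimal.isValid {f : ℝ} {π : ℝ → ℝ} (h : IsMinimal f π) : IsValid f intSubgroup π := by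
  refine ⟨h.nonneg, fun y hy => ?_⟩
  have hconv : Convex ℝ {y : ℝ →₀ ℝ | 1 ≤ y.sum fun r c => π r * c} := by
    simp only [sum_eq_linearCombination]
    exact convex_halfSpace_ge (Finsupp.linearCombination ℝ π).isLinear 1
  refine convexHull_min ?_ hconv hy
  rintro y ⟨n, hn, z, hz⟩
  have hyn : y = n.mapRange (fun k : ℕ => (k : ℝ)) (by simp) := by
    ext r
    simp [hn]
  have hz' : (n.sum fun r k => k • r) = f + (z : ℝ) := by
    have : ((z : ℤ) : ℝ) = (n.sum fun r k => k • r) - f := hz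
    linarith
  have hle : π (n.sum fun r k => k • r) ≤ n.sum fun r k => π (k • r) :=
    Finset.le_sum_of_subadditive π h.zero.le h.subadd n.support fun r => n r • r
  rw [mem_ofPred_eq, hyn, Finsupp.sum_mapRange_index (by simp)]
  rw [hz', h.periodic_int, h.apply_f] at hle
  refine hle.trans (Finset.sum_le_sum fun r _ => ?_)
  exact (h.nsmul_le r _).trans_eq (mul_comm _ _)

lemma IsValid.one_le_add_add {f : ℝ} {π : ℝ → ℝ} (h : IsValid f intSubgroup π) {x y z : ℝ} (k : ℤ)
    (hk : x + y + z = f + k) : 1 ≤ π x + π y + π z := by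
  have := h.2 (Finsupp.single x 1 + Finsupp.single y 1 + Finsupp.single z 1)
    (subset_convexHull ℝ _ ⟨Finsupp.single x 1 + Finsupp.single y 1 + Finsupp.single z 1, ?_, k, ?_⟩)
  · rw [sum_eq_linearCombination] at this
    simpa using this
  · intro r
    simp [Finsupp.single_apply]
  · have hs : ((Finsupp.single x 1 + Finsupp.single y 1 + Finsupp.single z 1 : ℝ →₀ ℕ).sum
        fun r k => k • r) = x + y + z := by
      rw [Finsupp.sum_add_index' (by simp) (by intros; simp [add_mul]),
        Finsupp.sum_add_index' (by simp) (by intros; simp [add_mul])]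
      simp
    rw [hs, hk]
    simp

/-- If a minimal function is the average of two valid functions, these are minimal too. -/
lemma IsMinimal.of_average {f : ℝ} {π π₁ π₂ : ℝ → ℝ} (h : IsMinimal f π)
    (h₁ : IsValid f intSubgroup π₁) (h₂ : IsValid f intSubgroup π₂)
    (havg : ∀ x, π x = (π₁ x + π₂ x) / 2) : IsMinimal f π₁ := by
  have zero : π₁ 0 = 0 := by
    have := havg 0
    rw [h.zero] at this
    linarith [h₁.1 0, h₂.1 0]
  have zero' : π₂ 0 = 0 := by
    have := havg 0
    rw [h.zero] at this
    linarith [h₁.1 0, h₂.1 0]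
  -- The corresponding sums for `π₁` and `π₂` are both at least `1` and average to `1`. The integer
  -- `k` is kept because periodicity of `π₁` is deduced from the cases `k = 0` and `k = 1`.
  have symm_int (x : ℝ) (k : ℤ) : π₁ x + π₁ (f - x + k) = 1 := by
    have e₁ := h₁.one_le_add_add (x := x) (y := f - x + k) (z := 0) k (by ring)
    have e₂ := h₂.one_le_add_add (x := x) (y := f - x + k) (z := 0) k (by ring)
    have e := h.symm x
    rw [← h.periodic_int (f - x) k, havg, havg (f - x + k)] at e
    linarith
  have symm (x : ℝ) : π₁ x + π₁ (f - x) = 1 := by simpa using symm_int x 0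
  refine ⟨h₁.1, zero, fun x => ?_, symm, fun x y => ?_⟩
  · have e₁ := symm_int (f - x) 1
    have e₂ := symm (f - x)
    simp only [sub_sub_cancel, Int.cast_one] at e₁ e₂
    linarith
  · have e₁ := h₁.one_le_add_add (x := x) (y := y) (z := f - (x + y)) 0 (by simp)
    have e₂ := symm (x + y)
    linarith

/-- A minimal function is extreme if it is no proper average of minimal functions. -/
lemma IsMinimal.isExtreme {f : ℝ} {π : ℝ → ℝ} (h : IsMinimal f π)
    (hrigid : ∀ g g', IsMinimal f g → IsMinimal f g' → (∀ x, π x = (g x + g' x) / 2) →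
      ∀ x, g x = π x) : IsExtreme f intSubgroup π := by
  refine ⟨h.isValid, fun π₁ π₂ h₁ h₂ havg => ?_⟩
  have ha (x : ℝ) : π x = (π₁ x + π₂ x) / 2 := by
    rw [havg]
    simp
    ring
  have ha' (x : ℝ) : π x = (π₂ x + π₁ x) / 2 := by rw [ha, add_comm]
  have m₁ := h.of_average h₁ h₂ ha
  have m₂ := h.of_average h₂ h₁ ha'
  exact ⟨funext fun x => (hrigid _ _ m₁ m₂ ha x).symm, funext fun x => (hrigid _ _ m₂ m₁ ha' x).symm⟩

/-- The subadditivity slacks of `g` and `g'` are nonnegative and average to zero. -/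
lemma additive_of_average {f : ℝ} {π g g' : ℝ → ℝ} (hg : IsMinimal f g) (hg' : IsMinimal f g')
    (havg : ∀ x, π x = (g x + g' x) / 2) {x y : ℝ} (h : π (x + y) = π x + π y) :
    g (x + y) = g x + g y := by
  have := hg.subadd x y
  have := hg'.subadd x y
  rw [havg, havg x, havg y] at h
  linarith

lemma half_notMem_intSubgroup : (1 / 2 : ℝ) ∉ intSubgroup := by
  rintro ⟨k, hk⟩
  have hk' : (k : ℝ) = 1 / 2 := hk
  have : ((2 * k : ℤ) : ℝ) = ((1 : ℤ) : ℝ) := by push_cast; linarith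
  have := Int.cast_injective this
  omega

/-! ### Cauchy's equation on intervals -/

/-- A bounded solution of Cauchy's equation on `[0, r]` is linear. -/
lemma linear_of_additive_of_bounded {ψ : ℝ → ℝ} {r M : ℝ} (hr : 0 < r)
    (hadd : ∀ x y, 0 ≤ x → 0 ≤ y → x + y ≤ r → ψ (x + y) = ψ x + ψ y)
    (hM : ∀ x, 0 ≤ x → x ≤ r → |ψ x| ≤ M) {x : ℝ} (hx : 0 ≤ x) (hxr : x ≤ r) :
    ψ x = ψ r / r * x := by
  set χ : ℝ → ℝ := fun x => ψ x - ψ r / r * x with hχ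
  have hχr : χ r = 0 := by simp only [hχ]; field_simp; ring
  have hχadd : ∀ x y, 0 ≤ x → 0 ≤ y → x + y ≤ r → χ (x + y) = χ x + χ y := by
    intro x y h₁ h₂ h₃
    simp only [hχ, hadd x y h₁ h₂ h₃]
    ring
  -- After subtracting the chord, `χ r = 0`. Doubling halves any bound on `[0, r/2]`, and `χ x = -χ
  -- (r - x)` carries the halved bound to the other half.
  have key : ∀ n : ℕ, ∀ x, 0 ≤ x → x ≤ r → |χ x| ≤ (M + M) * (1 / 2) ^ n := by
    intro n
    induction n with
    | zero =>
      intro x h₀ h₁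
      have h₂ := hM x h₀ h₁
      have h₃ := hM r hr.le le_rfl
      have h₄ : |ψ r / r * x| ≤ M := by
        have h₅ : ψ r / r * x = ψ r * (x / r) := by ring
        rw [h₅, abs_mul, abs_of_nonneg (div_nonneg h₀ hr.le)]
        have h₆ : x / r ≤ 1 := (div_le_one hr).2 h₁
        nlinarith [abs_nonneg (ψ r), div_nonneg h₀ hr.le]
      have := abs_sub (ψ x) (ψ r / r * x)
      simp only [hχ, pow_zero, mul_one]
      linarith
    | succ n ih =>
      have small : ∀ x, 0 ≤ x → x ≤ r / 2 → |χ x| ≤ (M + M) * (1 / 2) ^ (n + 1) := by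
        intro x h₀ h₁
        have h₂ := ih (x + x) (by linarith) (by linarith)
        rw [hχadd x x h₀ h₀ (by linarith), ← two_mul, abs_mul, abs_two] at h₂
        rw [pow_succ]
        linarith
      intro x h₀ h₁
      rcases le_total x (r / 2) with h | h
      · exact small x h₀ h
      · have h₂ := hχadd x (r - x) h₀ (by linarith) (by linarith)
        rw [add_sub_cancel, hχr] at h₂
        have h₃ : χ x = -χ (r - x) := by linarith
        rw [h₃, abs_neg]
        exact small _ (by linarith) (by linarith)
  have hlim : Tendsto (fun n : ℕ => (M + M) * (1 / 2 : ℝ) ^ n) atTop (𝓝 0) := by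
    simpa using (tendsto_pow_atTop_nhds_zero_of_lt_one (r := (1 / 2 : ℝ)) (by norm_num)
      (by norm_num)).const_mul (M + M)
  have : |χ x| ≤ 0 := ge_of_tendsto' hlim fun n => key n x hx hxr
  have h0 : χ x = 0 := abs_nonpos_iff.1 this
  simp only [hχ] at h0
  linarith

/-- A bounded function which is additive on `[a, 4a]` is linear there. -/
lemma linear_of_additive_Icc {g : ℝ → ℝ} {a M : ℝ} (ha : 0 < a)
    (hadd : ∀ x y, a ≤ x → a ≤ y → x + y ≤ 4 * a → g (x + y) = g x + g y)
    (hM : ∀ x, a ≤ x → x ≤ 4 * a → |g x| ≤ M) {x : ℝ} (hx : a ≤ x) (hx' : x ≤ 4 * a) :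
    g x = g (4 * a) / (4 * a) * x := by
  have h2 : g (2 * a) = g a + g a := by
    rw [two_mul]
    exact hadd a a le_rfl le_rfl (by linarith)
  -- Comparing `(a + s) + (a + t)` with `a + (a + s + t)` shows that `t ↦ g (a + t) - g a` solves
  -- Cauchy's equation on `[0, a]`. The sums reach `3a`, hence the room up to `4a`.
  have low : ∀ x, a ≤ x → x ≤ 2 * a → g x = g a / a * x := by
    intro x h₁ h₂
    have hψ := linear_of_additive_of_bounded (ψ := fun t => g (a + t) - g a) (r := a) (M := M + M) ha
      (fun s t hs ht hst => by
        have e₁ := hadd (a + s) (a + t) (by linarith) (by linarith) (by linarith)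
        have e₂ := hadd a (a + (s + t)) le_rfl (by linarith) (by linarith)
        have e₃ : a + s + (a + t) = a + (a + (s + t)) := by ring
        rw [e₃] at e₁
        linarith)
      (fun t ht ht' => by
        have e₁ := hM (a + t) (by linarith) (by linarith)
        have e₂ := hM a le_rfl (by linarith)
        have := abs_sub (g (a + t)) (g a)
        linarith)
      (x := x - a) (by linarith) (by linarith)
    simp only [add_sub_cancel, ← two_mul, h2] at hψ
    have : g x = g a + (2 * g a - g a) / a * (x - a) := by linarith
    rw [this]
    field_simp
    ring
  have all : ∀ x, a ≤ x → x ≤ 4 * a → g x = g a / a * x := by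
    intro x h₁ h₂
    rcases le_total x (2 * a) with h | h
    · exact low x h₁ h
    · have e := hadd (x / 2) (x / 2) (by linarith) (by linarith) (by linarith)
      rw [add_halves, low (x / 2) (by linarith) (by linarith)] at e
      rw [e]
      ring
  rw [all x hx hx', all (4 * a) (by linarith) le_rfl]
  field_simp

/-! ### One-sided affine behaviour, breakpoints and derivatives -/

section

/-- Just to the right of `x`, the function `π` is affine with gradient `c` and limit `d` at `x`. -/
def RightAffine (π : ℝ → ℝ) (x c d : ℝ) : Prop :=
  ∃ ε > 0, ∀ t, 0 < t → t < ε → π (x + t) = d + c * t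

/-- Just to the left of `x`, the function `π` is affine with gradient `c` and limit `d` at `x`. -/
def LeftAffine (π : ℝ → ℝ) (x c d : ℝ) : Prop :=
  ∃ ε > 0, ∀ t, 0 < t → t < ε → π (x - t) = d - c * t

variable {π : ℝ → ℝ} {x c d : ℝ}

lemma RightAffine.eventually (h : RightAffine π x c d) :
    π =ᶠ[𝓝[>] x] fun y => d + c * (y - x) := by
  obtain ⟨ε, hε, h⟩ := h
  filter_upwards [Ioo_mem_nhdsGT (show x < x + ε by linarith)] with y hy
  have := h (y - x) (by linarith [hy.1]) (by linarith [hy.2])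
  rwa [add_sub_cancel] at this

lemma LeftAffine.eventually (h : LeftAffine π x c d) :
    π =ᶠ[𝓝[<] x] fun y => d + c * (y - x) := by
  obtain ⟨ε, hε, h⟩ := h
  filter_upwards [Ioo_mem_nhdsLT (show x - ε < x by linarith)] with y hy
  have := h (x - y) (by linarith [hy.2]) (by linarith [hy.1])
  rw [sub_sub_cancel] at this
  rw [this]
  ring

lemma tendsto_affine (l : Filter ℝ) (hl : l ≤ 𝓝 x) :
    Tendsto (fun y => d + c * (y - x)) l (𝓝 d) := by
  have : Continuous fun y => d + c * (y - x) := by fun_prop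
  have h := (this.tendsto x).mono_left hl
  simpa using h

lemma RightAffine.tendsto (h : RightAffine π x c d) : Tendsto π (𝓝[>] x) (𝓝 d) :=
  (tendsto_affine _ nhdsWithin_le_nhds).congr' h.eventually.symm

lemma LeftAffine.tendsto (h : LeftAffine π x c d) : Tendsto π (𝓝[<] x) (𝓝 d) :=
  (tendsto_affine _ nhdsWithin_le_nhds).congr' h.eventually.symm

lemma RightAffine.not_continuousWithinAt (h : RightAffine π x c d) (hd : d ≠ π x) :
    ¬ ContinuousWithinAt π (Ioi x) x :=
  fun hc => hd (tendsto_nhds_unique h.tendsto hc)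

lemma LeftAffine.not_continuousWithinAt (h : LeftAffine π x c d) (hd : d ≠ π x) :
    ¬ ContinuousWithinAt π (Iio x) x :=
  fun hc => hd (tendsto_nhds_unique h.tendsto hc)

lemma continuous_of_right_left (hR : ∀ x, ∃ c, RightAffine π x c (π x))
    (hL : ∀ x, ∃ c, LeftAffine π x c (π x)) : Continuous π := by
  refine continuous_iff_continuousAt.2 fun x => continuousAt_iff_continuous_left'_right'.2 ?_
  obtain ⟨c, hc⟩ := hR x
  obtain ⟨c', hc'⟩ := hL x
  exact ⟨hc'.tendsto, hc.tendsto⟩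

lemma RightAffine.eq_of_hasDerivAt (h : RightAffine π x c d) {m : ℝ} (hm : HasDerivAt π m x) :
    m = c := by
  have hd : d = π x := tendsto_nhds_unique h.tendsto (hm.continuousAt.mono_left nhdsWithin_le_nhds)
  have h₁ : HasDerivWithinAt (fun y => d + c * (y - x)) c (Ioi x) x := by
    simpa using ((((hasDerivAt_id x).sub_const x).const_mul c).const_add d).hasDerivWithinAt
  have h₂ := h₁.congr_of_eventuallyEq h.eventually (by simp [hd])
  exact (uniqueDiffWithinAt_Ioi x).eq_deriv _ hm.hasDerivWithinAt h₂

lemma LeftAffine.eq_of_hasDerivAt (h : LeftAffine π x c d) {m : ℝ} (hm : HasDerivAt π m x) :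
    m = c := by
  have hd : d = π x := tendsto_nhds_unique h.tendsto (hm.continuousAt.mono_left nhdsWithin_le_nhds)
  have h₁ : HasDerivWithinAt (fun y => d + c * (y - x)) c (Iio x) x := by
    simpa using ((((hasDerivAt_id x).sub_const x).const_mul c).const_add d).hasDerivWithinAt
  have h₂ := h₁.congr_of_eventuallyEq h.eventually (by simp [hd])
  exact (uniqueDiffWithinAt_Iio x).eq_deriv _ hm.hasDerivWithinAt h₂

lemma hasDerivAt_of_affine {a b : ℝ} (h : ∀ y ∈ Ioo a b, π y = d + c * y) (hx : x ∈ Ioo a b) :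
    HasDerivAt π c x := by
  have h₁ : HasDerivAt (fun y => d + c * y) c x := by
    simpa using ((hasDerivAt_id x).const_mul c).const_add d
  refine h₁.congr_of_eventuallyEq ?_
  filter_upwards [Ioo_mem_nhds hx.1 hx.2] with y hy using h y hy

/-- The points around which a function is not affine. -/
def breakpoints (π : ℝ → ℝ) : Set ℝ := {x | ¬ ∃ c d, π =ᶠ[𝓝 x] fun y => d + c * y}

/-- Local affinity makes the derivative locally constant, hence constant on the connected interval.
-/
lemma affineOver_of_disjoint_breakpoints {a b : ℝ} (h : Disjoint (Ioo a b) (breakpoints π)) :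
    AffineOver π (Ioo a b) := by
  have hloc : ∀ x ∈ Ioo a b, ∃ c d, π =ᶠ[𝓝 x] fun y => d + c * y := fun x hx =>
    not_not.1 (Set.disjoint_left.1 h hx)
  have hderiv : ∀ x ∈ Ioo a b, ∃ c, HasDerivAt π c x ∧ deriv π =ᶠ[𝓝 x] fun _ => c := by
    intro x hx
    obtain ⟨c, d, hcd⟩ := hloc x hx
    have h₁ : ∀ x, HasDerivAt (fun y => d + c * y) c x := fun x => by
      simpa using ((hasDerivAt_id x).const_mul c).const_add d
    refine ⟨c, (h₁ x).congr_of_eventuallyEq hcd, hcd.deriv.trans ?_⟩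
    filter_upwards with y using (h₁ y).deriv
  have hconst : ∀ x ∈ Ioo a b, ∀ y ∈ Ioo a b, deriv π x = deriv π y := by
    intro x hx y hy
    refine isOpen_Ioo.is_const_of_deriv_eq_zero isPreconnected_Ioo ?_ ?_ hx hy
    · intro z hz
      obtain ⟨c, -, hc⟩ := hderiv z hz
      exact (((hasDerivAt_const z c).congr_of_eventuallyEq hc).differentiableAt).differentiableWithinAt
    · intro z hz
      obtain ⟨c, -, hc⟩ := hderiv z hz
      exact ((hasDerivAt_const z c).congr_of_eventuallyEq hc).deriv
  rcases (Ioo a b).eq_empty_or_nonempty with he | ⟨w, hw⟩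
  · exact ⟨0, by simp [he]⟩
  refine ⟨deriv π w, fun u hu v hv => ?_⟩
  have hd : ∀ x ∈ Ioo a b, HasDerivAt (fun y => π y - deriv π w * y) 0 x := by
    intro x hx
    obtain ⟨c, hc, -⟩ := hderiv x hx
    have h₁ := hc.fun_sub ((hasDerivAt_id x).const_mul (deriv π w))
    rw [hconst w hw x hx, hc.deriv] at h₁ ⊢
    simpa using h₁
  have := isOpen_Ioo.is_const_of_deriv_eq_zero isPreconnected_Ioo
    (fun x hx => (hd x hx).differentiableAt.differentiableWithinAt) (fun x hx => (hd x hx).deriv) hu hv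
  linarith

/-- Every point has a neighbourhood containing no breakpoint except possibly itself; compactness of
`[a, b]` does the rest. -/
lemma locallyFinite_breakpoints (hR : ∀ x, ∃ c d, RightAffine π x c d)
    (hL : ∀ x, ∃ c d, LeftAffine π x c d) : LocallyFiniteBreakpoints (breakpoints π) := by
  have hU : ∀ x, ∃ U ∈ 𝓝 x, breakpoints π ∩ U ⊆ {x} := by
    intro x
    obtain ⟨c, d, ε, hε, h⟩ := hR x
    obtain ⟨c', d', ε', hε', h'⟩ := hL x
    refine ⟨Ioo (x - ε') (x + ε), Ioo_mem_nhds (by linarith) (by linarith), ?_⟩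
    rintro y ⟨hy, hy₁, hy₂⟩
    by_contra hne
    apply hy
    rcases lt_or_gt_of_ne hne with hlt | hgt
    · refine ⟨c', d' - c' * x, ?_⟩
      filter_upwards [Ioo_mem_nhds hy₁ hlt] with z hz
      have := h' (x - z) (by linarith [hz.2]) (by linarith [hz.1])
      rw [sub_sub_cancel] at this
      rw [this]
      ring
    · refine ⟨c, d - c * x, ?_⟩
      filter_upwards [Ioo_mem_nhds hgt hy₂] with z hz
      have := h (z - x) (by linarith [hz.1]) (by linarith [hz.2])
      rw [add_sub_cancel] at this
      rw [this]
      ring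
  choose U hU hBU using hU
  intro a b
  obtain ⟨t, -, ht⟩ := (isCompact_Icc (a := a) (b := b)).elim_nhds_subcover U fun x _ => hU x
  refine t.finite_toSet.subset ?_
  rintro y ⟨hy, hyab⟩
  obtain ⟨x, hx, hyx⟩ := mem_iUnion₂.1 (ht hyab)
  have : y = x := hBU x ⟨hy, hyx⟩
  exact this ▸ hx

lemma isPiecewiseLinear_of_right_left (hR : ∀ x, ∃ c d, RightAffine π x c d)
    (hL : ∀ x, ∃ c d, LeftAffine π x c d) : IsPiecewiseLinear π :=
  ⟨breakpoints π, locallyFinite_breakpoints hR hL,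
    fun _ _ _ h => affineOver_of_disjoint_breakpoints h⟩

lemma isContinuousPiecewiseLinear_of_right_left (hR : ∀ x, ∃ c, RightAffine π x c (π x))
    (hL : ∀ x, ∃ c, LeftAffine π x c (π x)) : IsContinuousPiecewiseLinear π := by
  refine ⟨breakpoints π, locallyFinite_breakpoints (fun x => (hR x).imp fun c h => ⟨_, h⟩)
    (fun x => (hL x).imp fun c h => ⟨_, h⟩), fun a b hab h => ?_⟩
  obtain ⟨c, hc⟩ := affineOver_of_disjoint_breakpoints h
  have hcont := continuous_of_right_left hR hL
  refine ⟨c, ?_⟩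
  have hw : (a + b) / 2 ∈ Ioo a b := ⟨by linarith, by linarith⟩
  have heq : EqOn (fun y => π y - c * y) (fun _ => π ((a + b) / 2) - c * ((a + b) / 2))
      (Ioo a b) := by
    intro y hy
    have := hc _ hw y hy
    simp only
    linarith
  have := heq.closure (by fun_prop) (by fun_prop)
  rw [closure_Ioo hab.ne] at this
  intro u hu v hv
  have e₁ := this hu
  have e₂ := this hv
  simp only at e₁ e₂
  linarith

end

/-! ### Reduction to a fundamental domain -/

lemma exists_eq_add_int (x : ℝ) : ∃ u : ℝ, ∃ k : ℤ, -(1 / 2) ≤ u ∧ u < 1 / 2 ∧ x = u + k :=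
  ⟨x - ⌊x + 1 / 2⌋, ⌊x + 1 / 2⌋, by linarith [Int.floor_le (x + 1 / 2)],
    by linarith [Int.lt_floor_add_one (x + 1 / 2)], by ring⟩

lemma RightAffine.add_int {π : ℝ → ℝ} (hπ : ∀ x, ∀ k : ℤ, π (x + k) = π x) {x c d : ℝ}
    (h : RightAffine π x c d) (k : ℤ) : RightAffine π (x + k) c d := by
  obtain ⟨ε, hε, h⟩ := h
  refine ⟨ε, hε, fun t ht ht' => ?_⟩
  rw [add_right_comm, hπ]
  exact h t ht ht'

/-- Right-hand behaviour at `f - x` determines left-hand behaviour at `x`. -/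
lemma RightAffine.left_of_symm {π : ℝ → ℝ} {f : ℝ} (hπ : ∀ x, π x + π (f - x) = 1) {x c d : ℝ}
    (h : RightAffine π (f - x) c d) : LeftAffine π x c (1 - d) := by
  obtain ⟨ε, hε, h⟩ := h
  refine ⟨ε, hε, fun t ht ht' => ?_⟩
  have e₁ := h t ht ht'
  have e₂ := hπ (x - t)
  rw [show f - (x - t) = f - x + t by ring] at e₂
  linarith

/-- A criterion for minimality with `f = 1/2` in terms of a fundamental domain. -/
lemma isMinimal_half {π : ℝ → ℝ} (hper : ∀ x, ∀ k : ℤ, π (x + k) = π x) (hzero : π 0 = 0)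
    (hnonneg : ∀ x, -(1 / 2) ≤ x → x ≤ 1 / 2 → 0 ≤ π x)
    (hsymm : ∀ x, -(1 / 2) ≤ x → x ≤ 1 / 2 → π x + π (1 / 2 - x) = 1)
    (hsub : ∀ x y, -(1 / 2) ≤ x → x ≤ 1 / 2 → -(1 / 2) ≤ y → y ≤ 1 / 2 → π (x + y) ≤ π x + π y) :
    IsMinimal (1 / 2) π where
  nonneg x := by
    obtain ⟨u, k, h₁, h₂, rfl⟩ := exists_eq_add_int x
    rw [hper]
    exact hnonneg u h₁ h₂.le
  zero := hzero
  periodic x := by simpa using hper x 1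
  symm x := by
    obtain ⟨u, k, h₁, h₂, rfl⟩ := exists_eq_add_int x
    have e : (1 / 2 : ℝ) - (u + k) = 1 / 2 - u + (-k : ℤ) := by push_cast; ring
    rw [e, hper, hper]
    exact hsymm u h₁ h₂.le
  subadd x y := by
    obtain ⟨u, k, h₁, h₂, rfl⟩ := exists_eq_add_int x
    obtain ⟨v, l, h₃, h₄, rfl⟩ := exists_eq_add_int y
    have e : u + k + (v + l) = u + v + (k + l : ℤ) := by push_cast; ring
    rw [e, hper, hper, hper]
    exact hsub u v h₁ h₂.le h₃ h₄.le

/-! ### Staircases and their periodic lifts -/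

/-- A nondecreasing star-shaped function on `[0, 1/4]`, going from `0` to `1`. -/
structure IsStair (K : ℝ → ℝ) : Prop where
  zero : K 0 = 0
  top : K (1 / 4) = 1
  mono : ∀ x y, 0 ≤ x → x ≤ y → y ≤ 1 / 4 → K x ≤ K y
  star : ∀ x y, 0 < x → x ≤ y → y ≤ 1 / 4 → x * K y ≤ y * K x

/-- The extension of `K` to `[-1/2, 1/2]`: zero to the left of the origin, and point symmetric
about `1/4`. -/
noncomputable def stairExt (K : ℝ → ℝ) (x : ℝ) : ℝ :=
  if x ≤ 0 then 0 else if x ≤ 1 / 4 then K x else 2 - K (1 / 2 - x)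

/-- The periodic function which is `stairExt K x - 2 x` on `[-1/2, 1/2]`. -/
noncomputable def stairLift (K : ℝ → ℝ) (x : ℝ) : ℝ :=
  stairExt K (x - ⌊x + 1 / 2⌋) - 2 * (x - ⌊x + 1 / 2⌋)

lemma stairLift_add_int (K : ℝ → ℝ) (x : ℝ) (k : ℤ) : stairLift K (x + k) = stairLift K x := by
  have : ⌊x + k + 1 / 2⌋ = ⌊x + 1 / 2⌋ + k := by rw [add_right_comm, Int.floor_add_intCast]
  simp only [stairLift, this]
  push_cast
  rw [add_sub_add_right_eq_sub]

namespace IsStair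

variable {K : ℝ → ℝ}

lemma stairExt_low (hK : IsStair K) {x : ℝ} (h₀ : 0 ≤ x) (h₁ : x ≤ 1 / 4) :
    stairExt K x = K x := by
  unfold stairExt
  split_ifs with h
  · rw [le_antisymm h h₀, hK.zero]
  · rfl

lemma stairExt_high (hK : IsStair K) {x : ℝ} (h₀ : 1 / 4 ≤ x) :
    stairExt K x = 2 - K (1 / 2 - x) := by
  unfold stairExt
  split_ifs with h h'
  · linarith
  · rw [le_antisymm h' h₀, show (1 / 2 - 1 / 4 : ℝ) = 1 / 4 by norm_num, hK.top]
    norm_num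
  · rfl

lemma nonneg (hK : IsStair K) {x : ℝ} (h₀ : 0 ≤ x) (h₁ : x ≤ 1 / 4) : 0 ≤ K x :=
  hK.zero ▸ hK.mono 0 x le_rfl h₀ h₁

lemma le_one (hK : IsStair K) {x : ℝ} (h₀ : 0 ≤ x) (h₁ : x ≤ 1 / 4) : K x ≤ 1 :=
  hK.top ▸ hK.mono x (1 / 4) h₀ h₁ le_rfl

lemma four_mul_le (hK : IsStair K) {x : ℝ} (h₀ : 0 ≤ x) (h₁ : x ≤ 1 / 4) : 4 * x ≤ K x := by
  rcases h₀.eq_or_lt with rfl | h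
  · simp [hK.zero]
  · have := hK.star x (1 / 4) h h₁ le_rfl
    rw [hK.top] at this
    linarith

/-- Since `K x / x` is nonincreasing, `K x` and `K y` are at least the shares `x / (x + y)` and `y /
(x + y)` of `K (x + y)`. -/
lemma subadd (hK : IsStair K) {x y : ℝ} (hx : 0 ≤ x) (hy : 0 ≤ y) (hxy : x + y ≤ 1 / 4) :
    K (x + y) ≤ K x + K y := by
  rcases hx.eq_or_lt with rfl | hx'
  · simp [hK.zero]
  rcases hy.eq_or_lt with rfl | hy'
  · simp [hK.zero]
  have e₁ := hK.star x (x + y) hx' (by linarith) hxy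
  have e₂ := hK.star y (x + y) hy' (by linarith) hxy
  refine le_of_mul_le_mul_left ?_ (add_pos hx' hy')
  linarith

lemma stairExt_symm (hK : IsStair K) {x : ℝ} (h₀ : 0 ≤ x) (h₁ : x ≤ 1 / 2) :
    stairExt K x + stairExt K (1 / 2 - x) = 2 := by
  rcases le_total x (1 / 4) with h | h
  · rw [hK.stairExt_low h₀ h, hK.stairExt_high (by linarith), sub_sub_cancel]
    ring
  · rw [hK.stairExt_high h, hK.stairExt_low (by linarith) (by linarith)]
    ring

lemma stairExt_mono (hK : IsStair K) {x y : ℝ} (h₀ : x ≤ y) (h₁ : y ≤ 1 / 2) :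
    stairExt K x ≤ stairExt K y := by
  rcases le_total x 0 with hx | hx
  · have e : stairExt K x = 0 := if_pos hx
    rw [e]
    rcases le_total y 0 with hy | hy
    · exact (if_pos hy : stairExt K y = 0).ge
    rcases le_total y (1 / 4) with hy' | hy'
    · rw [hK.stairExt_low hy hy']
      exact hK.nonneg hy hy'
    · rw [hK.stairExt_high hy']
      linarith [hK.le_one (x := 1 / 2 - y) (by linarith) (by linarith)]
  rcases le_total y (1 / 4) with hy | hy
  · rw [hK.stairExt_low hx (h₀.trans hy), hK.stairExt_low (hx.trans h₀) hy]
    exact hK.mono x y hx h₀ hy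
  rw [hK.stairExt_high hy]
  have e := hK.le_one (x := 1 / 2 - y) (by linarith) (by linarith)
  rcases le_total x (1 / 4) with hx' | hx'
  · rw [hK.stairExt_low hx hx']
    linarith [hK.le_one hx hx']
  · rw [hK.stairExt_high hx']
    linarith [hK.mono (1 / 2 - y) (1 / 2 - x) (by linarith) (by linarith) (by linarith)]

lemma stairExt_subadd (hK : IsStair K) {x y : ℝ} (hx : 0 ≤ x) (hy : 0 ≤ y) (hxy : x + y ≤ 1 / 2) :
    stairExt K (x + y) ≤ stairExt K x + stairExt K y := by
  wlog h : x ≤ y generalizing x y with H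
  · rw [add_comm, add_comm (stairExt K x)]
    exact H hy hx (by linarith) (by linarith)
  have hx4 : x ≤ 1 / 4 := by linarith
  rw [hK.stairExt_low hx hx4]
  rcases le_total y (1 / 4) with hy' | hy'
  · rw [hK.stairExt_low hy hy']
    rcases le_total (x + y) (1 / 4) with hs | hs
    · rw [hK.stairExt_low (by linarith) hs]
      exact hK.subadd hx hy hs
    · rw [hK.stairExt_high hs]
      -- The points `x`, `y`, `1/2 - (x + y)` add up to `1/2`, so `4t ≤ K t` makes their values add
      -- up to at least `2`.
      linarith [hK.four_mul_le hx hx4, hK.four_mul_le hy hy',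
        hK.four_mul_le (x := 1 / 2 - (x + y)) (by linarith) (by linarith)]
  · rw [hK.stairExt_high hy', hK.stairExt_high (by linarith)]
    -- Reflection in the point of symmetry turns the claim into subadditivity of `K` at `x` and `1/2
    -- - (x + y)`.
    have := hK.subadd (x := x) (y := 1 / 2 - (x + y)) hx (by linarith) (by linarith)
    rw [show x + (1 / 2 - (x + y)) = 1 / 2 - y by ring] at this
    linarith

lemma stairLift_eq (hK : IsStair K) {x : ℝ} (h₀ : -(1 / 2) ≤ x) (h₁ : x ≤ 1 / 2) :
    stairLift K x = stairExt K x - 2 * x := by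
  -- The point `1/2` is reduced to `-1/2` in the definition; both formulas give `1`.
  rcases h₁.eq_or_lt with rfl | h
  · have e : stairExt K (1 / 2) = 2 := by
      rw [hK.stairExt_high (by norm_num), sub_self, hK.zero, sub_zero]
    have e' : stairExt K (1 / 2 - 1) = 0 := if_pos (by norm_num)
    rw [stairLift, add_halves, Int.floor_one, Int.cast_one, e, e']
    norm_num
  · have : ⌊x + 1 / 2⌋ = 0 := Int.floor_eq_zero_iff.2 ⟨by linarith, by linarith⟩
    rw [stairLift, this]
    simp

lemma stairLift_neg (hK : IsStair K) {x : ℝ} (h₀ : -(1 / 2) ≤ x) (h₁ : x ≤ 0) :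
    stairLift K x = -2 * x := by
  have e : stairExt K x = 0 := if_pos h₁
  rw [hK.stairLift_eq h₀ (by linarith), e]
  ring

lemma stairLift_low (hK : IsStair K) {x : ℝ} (h₀ : 0 ≤ x) (h₁ : x ≤ 1 / 4) :
    stairLift K x = K x - 2 * x := by
  rw [hK.stairLift_eq (by linarith) (by linarith), hK.stairExt_low h₀ h₁]

lemma stairLift_high (hK : IsStair K) {x : ℝ} (h₀ : 1 / 4 ≤ x) (h₁ : x ≤ 1 / 2) :
    stairLift K x = 2 - K (1 / 2 - x) - 2 * x := by
  rw [hK.stairLift_eq (by linarith) (by linarith), hK.stairExt_high h₀]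

lemma stairLift_symm (hK : IsStair K) {x : ℝ} (h₀ : -(1 / 2) ≤ x) (h₁ : x ≤ 1 / 2) :
    stairLift K x + stairLift K (1 / 2 - x) = 1 := by
  rcases le_total x 0 with h | h
  · have e : (1 / 2 - x : ℝ) = -(1 / 2) - x + (1 : ℤ) := by push_cast; ring
    rw [e, stairLift_add_int, hK.stairLift_neg h₀ h, hK.stairLift_neg (by linarith) (by linarith)]
    ring
  · rw [hK.stairLift_eq h₀ h₁, hK.stairLift_eq (by linarith) (by linarith)]
    linarith [hK.stairExt_symm h h₁]

lemma stairLift_nonneg (hK : IsStair K) {x : ℝ} (h₀ : -(1 / 2) ≤ x) (h₁ : x ≤ 1 / 2) :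
    0 ≤ stairLift K x := by
  rcases le_total x 0 with h | h
  · rw [hK.stairLift_neg h₀ h]
    linarith
  rcases le_total x (1 / 4) with h' | h'
  · rw [hK.stairLift_low h h']
    linarith [hK.four_mul_le h h']
  · rw [hK.stairLift_high h' h₁]
    linarith [hK.le_one (x := 1 / 2 - x) (by linarith) (by linarith)]

lemma stairLift_subadd (hK : IsStair K) {x y : ℝ} (hx : -(1 / 2) ≤ x) (hx' : x ≤ 1 / 2)
    (hy : -(1 / 2) ≤ y) (hy' : y ≤ 1 / 2) :
    stairLift K (x + y) ≤ stairLift K x + stairLift K y := by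
  wlog h : x ≤ y generalizing x y with H
  · rw [add_comm, add_comm (stairLift K x)]
    exact H hy hy' hx hx' (by linarith)
  rcases le_total y 0 with hy0 | hy0
  · rw [hK.stairLift_neg hx (by linarith), hK.stairLift_neg hy hy0]
    rcases le_total (-(1 / 2)) (x + y) with hs | hs
    · rw [hK.stairLift_neg hs (by linarith)]
      linarith
    · rw [← stairLift_add_int K _ 1]
      push_cast
      have e₁ := hK.stairLift_symm (x := x + y + 1) (by linarith) (by linarith)
      have e₂ := hK.stairLift_nonneg (x := 1 / 2 - (x + y + 1)) (by linarith) (by linarith)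
      linarith
  rcases le_total x 0 with hx0 | hx0
  · rw [hK.stairLift_neg hx hx0, hK.stairLift_eq hy hy', hK.stairLift_eq (by linarith) (by linarith)]
    linarith [hK.stairExt_mono (x := x + y) (y := y) (by linarith) hy']
  rw [hK.stairLift_eq hx hx', hK.stairLift_eq hy hy']
  rcases le_total (x + y) (1 / 2) with hs | hs
  · rw [hK.stairLift_eq (by linarith) hs]
    linarith [hK.stairExt_subadd hx0 hy0 hs]
  -- The sum wraps around into `[-1/2, 0]`. What remains is that the two values of `stairExt` add up
  -- to at least `2`, which follows from `y ≥ 1/2 - x` by monotonicity and symmetry.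
  · rw [← stairLift_add_int K _ (-1), hK.stairLift_neg (by push_cast; linarith)
      (by push_cast; linarith)]
    push_cast
    linarith [hK.stairExt_symm hx0 hx', hK.stairExt_mono (x := 1 / 2 - x) (y := y) (by linarith) hy']

lemma isMinimal (hK : IsStair K) : IsMinimal (1 / 2) (stairLift K) :=
  isMinimal_half (stairLift_add_int K)
    (by rw [hK.stairLift_low le_rfl (by norm_num), hK.zero, mul_zero, sub_zero])
    (fun _ => hK.stairLift_nonneg) (fun _ => hK.stairLift_symm) (fun _ _ => hK.stairLift_subadd)

end IsStair

/-- The function `k` inherits from `K` the additivity relations and the intervals of constancy. -/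
structure Inherits (k K : ℝ → ℝ) : Prop where
  zero : k 0 = 0
  top : k (1 / 4) = 1
  bounded : ∃ M, ∀ x, 0 ≤ x → x ≤ 1 / 4 → |k x| ≤ M
  additive : ∀ x y, 0 ≤ x → 0 ≤ y → x + y ≤ 1 / 4 → K (x + y) = K x + K y → k (x + y) = k x + k y
  const : ∀ x y, 0 ≤ x → x ≤ y → y ≤ 1 / 4 → K x = K y → k x = k y

/-- On `[-1/2, 0]` the lift is additive, so a component `g` is linear there, and `g (-1/2) = g (1/2)
= 1` fixes it. Then `g x + 2x` inherits from `K`, which settles `[0, 1/4]`; symmetry covers `[1/4,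
1/2]`. -/
lemma IsStair.isExtreme {K : ℝ → ℝ} (hK : IsStair K)
    (hrigid : ∀ k, Inherits k K → ∀ x, 0 ≤ x → x ≤ 1 / 4 → k x = K x) :
    IsExtreme (1 / 2) intSubgroup (stairLift K) := by
  refine hK.isMinimal.isExtreme fun g g' hg hg' havg => ?_
  have hadd {x y : ℝ} := additive_of_average hg hg' havg (x := x) (y := y)
  have hneg : ∀ x, -(1 / 2) ≤ x → x ≤ 0 → g x = -2 * x := by
    intro x h₀ h₁
    have e := linear_of_additive_of_bounded (ψ := fun t => g (-t)) (r := 1 / 2) (M := 1)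
      (by norm_num)
      (fun s t hs ht hst => by
        simp only [neg_add]
        apply hadd
        rw [hK.stairLift_neg (by linarith) (by linarith), hK.stairLift_neg (by linarith)
          (by linarith), hK.stairLift_neg (by linarith) (by linarith)]
        ring)
      (fun t _ _ => abs_le.2 ⟨by linarith [hg.nonneg (-t)], hg.le_one _⟩)
      (x := -x) (by linarith) (by linarith)
    have e₁ : g (-(1 / 2)) = 1 := by
      rw [← hg.periodic, show -(1 / 2) + 1 = (1 / 2 : ℝ) by norm_num, hg.apply_f]
    simp only [neg_neg, e₁] at e
    rw [e]
    ring
  have hinh : Inherits (fun x => g x + 2 * x) K := by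
    refine ⟨by simp [hg.zero], ?_, ⟨2, fun x h₀ h₁ => abs_le.2 ⟨?_, ?_⟩⟩, ?_, ?_⟩
    · have := hg.symm (1 / 4)
      norm_num at this
      linarith
    · linarith [hg.nonneg x]
    · linarith [hg.le_one x]
    · intro x y hx hy hxy h
      have := hadd (x := x) (y := y) (by
        rw [hK.stairLift_low (by linarith) hxy, hK.stairLift_low hx (by linarith),
          hK.stairLift_low hy (by linarith), h]
        ring)
      linarith
    · intro x y hx hxy hy h
      -- Moving left from `y` to `x` by the descending piece is additive exactly because `K x = K
      -- y`.
      have := hadd (x := y) (y := x - y) (by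
        rw [add_sub_cancel, hK.stairLift_low (by linarith) hy, hK.stairLift_low hx (by linarith),
          hK.stairLift_neg (by linarith) (by linarith), h]
        ring)
      rw [add_sub_cancel, hneg (x - y) (by linarith) (by linarith)] at this
      linarith
  have hlow : ∀ x, 0 ≤ x → x ≤ 1 / 4 → g x = stairLift K x := by
    intro x h₀ h₁
    rw [hK.stairLift_low h₀ h₁]
    linarith [hrigid _ hinh x h₀ h₁]
  intro x
  obtain ⟨u, k, h₀, h₁, rfl⟩ := exists_eq_add_int x
  rw [hg.periodic_int, hK.isMinimal.periodic_int]
  rcases le_total u 0 with h | h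
  · rw [hneg u h₀ h, hK.stairLift_neg h₀ h]
  rcases le_total u (1 / 4) with h' | h'
  · exact hlow u h h'
  · linarith [hlow (1 / 2 - u) (by linarith) (by linarith), hg.symm u, hK.isMinimal.symm u]

/-! ### Slopes of the lifts -/

section Slopes

variable {K : ℝ → ℝ} {T : Set ℝ} {Q : Prop}

/-- The set `T` collects the admissible gradients of `K`. The proposition `Q` serves as a switch:
`True` also tracks continuity, `False` permits jumps. Right-hand behaviour beyond `1/4` is left-hand
behaviour of `K` at the reflected point. -/
lemma IsStair.rightAffine_stairLift (hK : IsStair K) (hT : 0 ∈ T)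
    (hR : ∀ x, 0 ≤ x → x < 1 / 4 → ∃ c ∈ T, ∃ d, (Q → d = K x) ∧ RightAffine K x c d)
    (hL : ∀ x, 0 < x → x ≤ 1 / 4 → ∃ c ∈ T, ∃ d, (Q → d = K x) ∧ LeftAffine K x c d) (x : ℝ) :
    ∃ c ∈ T, ∃ d, (Q → d = stairLift K x) ∧ RightAffine (stairLift K) x (c - 2) d := by
  obtain ⟨u, k, h₀, h₁, rfl⟩ := exists_eq_add_int x
  suffices ∃ c ∈ T, ∃ d, (Q → d = stairLift K u) ∧ RightAffine (stairLift K) u (c - 2) d by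
    obtain ⟨c, hc, d, hd, h⟩ := this
    rw [stairLift_add_int]
    exact ⟨c, hc, d, hd, h.add_int (stairLift_add_int K) k⟩
  rcases lt_or_ge u 0 with hu | hu
  · refine ⟨0, hT, -2 * u, fun _ => (hK.stairLift_neg h₀ hu.le).symm, -u, by linarith,
      fun t ht ht' => ?_⟩
    rw [hK.stairLift_neg (by linarith) (by linarith)]
    ring
  rcases lt_or_ge u (1 / 4) with hu' | hu'
  · obtain ⟨c, hc, d, hd, ε, hε, h⟩ := hR u hu hu'
    refine ⟨c, hc, d - 2 * u, fun hQ => ?_, min ε (1 / 4 - u), lt_min hε (by linarith),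
      fun t ht ht' => ?_⟩
    · rw [hK.stairLift_low hu hu'.le, hd hQ]
    · have := ht'.trans_le (min_le_right _ _)
      rw [hK.stairLift_low (by linarith) (by linarith), h t ht (ht'.trans_le (min_le_left _ _))]
      ring
  · obtain ⟨c, hc, d, hd, ε, hε, h⟩ := hL (1 / 2 - u) (by linarith) (by linarith)
    refine ⟨c, hc, 2 - d - 2 * u, fun hQ => ?_, min ε (1 / 2 - u), lt_min hε (by linarith),
      fun t ht ht' => ?_⟩
    · rw [hK.stairLift_high hu' h₁.le, hd hQ]
    · have := ht'.trans_le (min_le_right _ _)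
      rw [hK.stairLift_high (by linarith) (by linarith), ← sub_sub,
        h t ht (ht'.trans_le (min_le_left _ _))]
      ring

lemma IsStair.leftAffine_stairLift (hK : IsStair K) (hT : 0 ∈ T)
    (hR : ∀ x, 0 ≤ x → x < 1 / 4 → ∃ c ∈ T, ∃ d, (Q → d = K x) ∧ RightAffine K x c d)
    (hL : ∀ x, 0 < x → x ≤ 1 / 4 → ∃ c ∈ T, ∃ d, (Q → d = K x) ∧ LeftAffine K x c d) (x : ℝ) :
    ∃ c ∈ T, ∃ d, (Q → d = stairLift K x) ∧ LeftAffine (stairLift K) x (c - 2) d := by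
  obtain ⟨c, hc, d, hd, h⟩ := hK.rightAffine_stairLift hT hR hL (1 / 2 - x)
  refine ⟨c, hc, 1 - d, fun hQ => ?_, h.left_of_symm hK.isMinimal.symm⟩
  linarith [hd hQ, hK.isMinimal.symm x]

lemma IsStair.slopes_stairLift (hK : IsStair K) (hT : 0 ∈ T)
    (hR : ∀ x, 0 ≤ x → x < 1 / 4 → ∃ c ∈ T, ∃ d, (Q → d = K x) ∧ RightAffine K x c d)
    (hL : ∀ x, 0 < x → x ≤ 1 / 4 → ∃ c ∈ T, ∃ d, (Q → d = K x) ∧ LeftAffine K x c d)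
    (hattain : ∀ c ∈ T, c ≠ 0 → ∃ a b d, 0 ≤ a ∧ a < b ∧ b ≤ 1 / 4 ∧
      ∀ x ∈ Ioo a b, K x = d + c * x) :
    slopes (stairLift K) = (fun c => c - 2) '' T := by
  ext m
  constructor
  · rintro ⟨x, hx⟩
    obtain ⟨c, hc, d, -, h⟩ := hK.rightAffine_stairLift hT hR hL x
    exact ⟨c, hc, (h.eq_of_hasDerivAt hx).symm⟩
  · rintro ⟨c, hc, rfl⟩
    rcases eq_or_ne c 0 with rfl | hc0
    · refine ⟨-(1 / 4), hasDerivAt_of_affine (a := -(1 / 2)) (b := 0) (d := 0) (fun y hy => ?_)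
        ⟨by norm_num, by norm_num⟩⟩
      rw [hK.stairLift_neg hy.1.le hy.2.le]
      ring
    · obtain ⟨a, b, d, ha, hab, hb, h⟩ := hattain c hc hc0
      refine ⟨(a + b) / 2, hasDerivAt_of_affine (a := a) (b := b) (d := d) (fun y hy => ?_)
        ⟨by linarith, by linarith⟩⟩
      rw [hK.stairLift_low (by linarith [hy.1]) (by linarith [hy.2]), h y hy]
      ring

end Slopes

/-! ### Modifying a staircase near the origin -/

/-- Replaces the initial part of `K`, of gradient `s`, by a piece of gradient `2 s` on `[0, δ]` and
a constant piece on `[δ, 2 δ]`. -/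
noncomputable def bump (K : ℝ → ℝ) (s δ x : ℝ) : ℝ :=
  if x ≤ δ then 2 * s * x else if x ≤ 2 * δ then 2 * s * δ else K x

/-- Makes `K` constant on `(0, e]`, with a jump at the origin. -/
noncomputable def flatten (K : ℝ → ℝ) (e x : ℝ) : ℝ :=
  if x ≤ 0 then 0 else if x ≤ e then K e else K x

section

variable {K : ℝ → ℝ} {s δ e x : ℝ}

lemma bump_low (h : x ≤ δ) : bump K s δ x = 2 * s * x := if_pos h

lemma bump_mid (h : δ ≤ x) (h' : x ≤ 2 * δ) : bump K s δ x = 2 * s * δ := by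
  unfold bump
  split_ifs with h₁
  · rw [le_antisymm h₁ h]
  · rfl

lemma bump_high (hδ : 0 < δ) (hs : K (2 * δ) = s * (2 * δ)) (h : 2 * δ ≤ x) :
    bump K s δ x = K x := by
  rcases h.eq_or_lt with rfl | h'
  · rw [bump_mid (by linarith) le_rfl, hs]
    ring
  · rw [bump, if_neg (by linarith), if_neg (by linarith)]

lemma flatten_zero : flatten K e 0 = 0 := if_pos le_rfl

lemma flatten_low (h : 0 < x) (h' : x ≤ e) : flatten K e x = K e := by
  rw [flatten, if_neg (by linarith), if_pos h']

lemma flatten_high (he : 0 < e) (h : e ≤ x) : flatten K e x = K x := by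
  rcases h.eq_or_lt with rfl | h'
  · exact flatten_low he le_rfl
  · rw [flatten, if_neg (by linarith), if_neg (by linarith)]

/-- The ratio of value to argument is `2s` up to `δ`, falls from `2s` to `s` on `[δ, 2δ]`, and
afterwards is that of `K`, which stays at most `s` by star-shapedness from `2δ`. -/
lemma IsStair.bump (hK : IsStair K) (hs₀ : 0 ≤ s) (hδ : 0 < δ) (hδ' : 2 * δ ≤ 1 / 4)
    (hs : K (2 * δ) = s * (2 * δ)) : IsStair (bump K s δ) := by
  have hle : ∀ y, 2 * δ ≤ y → y ≤ 1 / 4 → K y ≤ s * y := by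
    intro y h₁ h₂
    have := hK.star (2 * δ) y (by linarith) h₁ h₂
    rw [hs] at this
    refine le_of_mul_le_mul_left ?_ (show 0 < 2 * δ by linarith)
    linarith
  refine ⟨by rw [bump_low hδ.le, mul_zero], by rw [bump_high hδ hs hδ', hK.top],
    fun x y hx hxy hy => ?_, fun x y hx hxy hy => ?_⟩
  · rcases le_total y δ with h | h
    · rw [bump_low h, bump_low (hxy.trans h)]
      gcongr
    have hle' : GroupProblem.bump K s δ x ≤ 2 * s * δ ∨ 2 * δ ≤ x := by
      rcases le_total x δ with h₁ | h₁
      · rw [bump_low h₁]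
        left
        gcongr
      · rcases le_total x (2 * δ) with h₂ | h₂
        · exact Or.inl (bump_mid h₁ h₂).le
        · exact Or.inr h₂
    rcases hle' with h₁ | h₁
    · refine h₁.trans ?_
      rcases le_total y (2 * δ) with h₂ | h₂
      · rw [bump_mid h h₂]
      · rw [bump_high hδ hs h₂]
        have := hK.mono (2 * δ) y (by linarith) h₂ hy
        rw [hs] at this
        linarith
    · rw [bump_high hδ hs h₁, bump_high hδ hs (h₁.trans hxy)]
      exact hK.mono x y hx hxy hy
  · rcases le_total y δ with h | h
    · rw [bump_low h, bump_low (hxy.trans h)]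
      exact le_of_eq (by ring)
    rcases le_total y (2 * δ) with h' | h'
    · rw [bump_mid h h']
      rcases le_total x δ with h₁ | h₁
      · rw [bump_low h₁]
        nlinarith [mul_nonneg (mul_nonneg hs₀ hx.le) (sub_nonneg.2 h)]
      · rw [bump_mid h₁ (hxy.trans h')]
        exact mul_le_mul_of_nonneg_right hxy (by positivity)
    · rw [bump_high hδ hs h']
      have hy₁ := mul_le_mul_of_nonneg_left (hle y h' hy) hx.le
      have hy₀ : 0 ≤ s * x * y := mul_nonneg (mul_nonneg hs₀ hx.le) (hx.le.trans hxy)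
      rcases le_total x δ with h₁ | h₁
      · rw [bump_low h₁]
        linarith
      rcases le_total x (2 * δ) with h₂ | h₂
      · rw [bump_mid h₁ h₂]
        nlinarith [mul_nonneg (mul_nonneg hs₀ (hx.le.trans hxy)) (sub_nonneg.2 h₂)]
      · rw [bump_high hδ hs h₂]
        exact hK.star x y hx hxy hy

lemma IsStair.flatten (hK : IsStair K) (he : 0 < e) (he' : e ≤ 1 / 4) :
    IsStair (flatten K e) := by
  refine ⟨flatten_zero, by rw [flatten_high he he', hK.top],
    fun x y hx hxy hy => ?_, fun x y hx hxy hy => ?_⟩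
  · rcases hx.eq_or_lt with rfl | hx
    · rw [flatten_zero]
      rcases hxy.eq_or_lt with rfl | hy₀
      · rw [flatten_zero]
      rcases le_total y e with h | h
      · rw [flatten_low hy₀ h]
        exact hK.nonneg he.le he'
      · rw [flatten_high he h]
        exact hK.nonneg hy₀.le hy
    rcases le_total x e with h | h
    · rw [flatten_low hx h]
      rcases le_total y e with h' | h'
      · rw [flatten_low (hx.trans_le hxy) h']
      · rw [flatten_high he h']
        exact hK.mono e y he.le h' hy
    · rw [flatten_high he h, flatten_high he (h.trans hxy)]
      exact hK.mono x y hx.le hxy hy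
  · rcases le_total x e with h | h
    · rw [flatten_low hx h]
      rcases le_total y e with h' | h'
      · rw [flatten_low (hx.trans_le hxy) h']
        exact mul_le_mul_of_nonneg_right hxy (hK.nonneg he.le he')
      · rw [flatten_high he h']
        exact (mul_le_mul_of_nonneg_right h (hK.nonneg (hx.le.trans hxy) hy)).trans
          (hK.star e y he h' hy)
    · rw [flatten_high he h, flatten_high he (h.trans hxy)]
      exact hK.star x y hx hxy hy

end

/-! ### The zigzag staircases: rigidity and gradients -/

/-- The widths of the bumps. -/
noncomputable def width (n : ℕ) : ℝ := (1 / 8) ^ n / 4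

lemma width_pos (n : ℕ) : 0 < width n := by unfold width; positivity

lemma width_zero : width 0 = 1 / 4 := by norm_num [width]

/-- The factor `8` gives `[2 * width (n + 1), width n]` the shape `[a, 4a]` needed in
`linear_of_additive_Icc`. -/
lemma width_succ (n : ℕ) : 8 * width (n + 1) = width n := by
  unfold width
  rw [pow_succ]
  ring

lemma width_anti {m n : ℕ} (h : m ≤ n) : width n ≤ width m := by
  unfold width
  gcongr ?_ / 4
  exact pow_le_pow_of_le_one (by norm_num) (by norm_num) h

lemma width_le (n : ℕ) : width n ≤ 1 / 4 := width_zero ▸ width_anti n.zero_le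

/-- The staircase with `n` constant pieces. -/
noncomputable def zigzag : ℕ → ℝ → ℝ
  | 0 => fun x => 4 * x
  | n + 1 => bump (zigzag n) (4 * 2 ^ n) (width (n + 1))

lemma zigzag_low (n : ℕ) {x : ℝ} (hx : x ≤ width n) : zigzag n x = 4 * 2 ^ n * x := by
  cases n with
  | zero => simp [zigzag]
  | succ n =>
    rw [zigzag, bump_low hx]
    ring

lemma zigzag_two_width (n : ℕ) :
    zigzag n (2 * width (n + 1)) = 4 * 2 ^ n * (2 * width (n + 1)) :=
  zigzag_low n (by linarith [width_succ n, width_pos (n + 1)])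

lemma zigzag_succ_mid (n : ℕ) {x : ℝ} (h : width (n + 1) ≤ x) (h' : x ≤ 2 * width (n + 1)) :
    zigzag (n + 1) x = zigzag n (2 * width (n + 1)) := by
  rw [zigzag, bump_mid h h', zigzag_two_width]
  ring

lemma zigzag_succ_high (n : ℕ) {x : ℝ} (h : 2 * width (n + 1) ≤ x) :
    zigzag (n + 1) x = zigzag n x := by
  rw [zigzag, bump_high (width_pos _) (zigzag_two_width n) h]

lemma zigzag_of_le {m n : ℕ} (hmn : m ≤ n) {x : ℝ} (h : 2 * width (m + 1) ≤ x) :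
    zigzag n x = zigzag m x := by
  induction n, hmn using Nat.le_induction with
  | base => rfl
  | succ n hmn ih =>
    rw [zigzag_succ_high n, ih]
    linarith [width_anti (Nat.succ_le_succ hmn)]

lemma isStair_zigzag (n : ℕ) : IsStair (zigzag n) := by
  induction n with
  | zero =>
    refine ⟨by simp [zigzag], by norm_num [zigzag], fun x y _ h _ => ?_, fun x y _ _ _ => ?_⟩
    · simp only [zigzag]
      linarith
    · simp only [zigzag]
      linarith
  | succ n ih =>
    exact ih.bump (by positivity) (width_pos _)
      (by linarith [width_succ n, width_pos (n + 1), width_le n]) (zigzag_two_width n)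

/-- Everything that inherits from a function which agrees with `zigzag n` away from the origin does
so as well. -/
lemma Inherits.eq_of_eq_zigzag {k K : ℝ → ℝ} (h : Inherits k K) (n : ℕ)
    (hK : ∀ x, 2 * width (n + 1) ≤ x → x ≤ 1 / 4 → K x = zigzag n x) :
    ∀ x, 2 * width (n + 1) ≤ x → x ≤ 1 / 4 → k x = K x := by
  obtain ⟨M, hM⟩ := h.bounded
  -- On this piece `K` lies on a line through the origin, so `k` is additive there and hence
  -- proportional to `x`; its value at the right end fixes the factor. The induction works through
  -- the pieces from right to left.
  have linear : ∀ n : ℕ, (∀ x, 2 * width (n + 1) ≤ x → x ≤ 1 / 4 → K x = zigzag n x) →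
      k (width n) = K (width n) → ∀ x, 2 * width (n + 1) ≤ x → x ≤ width n → k x = K x := by
    intro n hK hw x hx hx'
    have h₀ := width_pos (n + 1)
    have h₁ := width_succ n
    have h₂ := width_le n
    have hK' : ∀ y, 2 * width (n + 1) ≤ y → y ≤ width n → K y = 4 * 2 ^ n * y :=
      fun y hy hy' => by rw [hK y hy (hy'.trans h₂), zigzag_low n hy']
    have e := linear_of_additive_Icc (g := k) (a := 2 * width (n + 1)) (M := M) (by linarith)
      (fun y z hy hz hyz => h.additive y z (by linarith) (by linarith) (by linarith) (by
        rw [hK' y hy (by linarith), hK' z hz (by linarith), hK' _ (by linarith) (by linarith)]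
        ring))
      (fun y hy hy' => hM y (by linarith) (by linarith)) hx (by linarith)
    rw [show 4 * (2 * width (n + 1)) = width n by linarith, hw,
      hK' _ (by linarith) le_rfl] at e
    rw [e, hK' x hx hx', mul_div_assoc, div_self (width_pos n).ne', mul_one]
  induction n with
  | zero =>
    intro x hx hx'
    refine linear 0 hK ?_ x hx (width_zero ▸ hx')
    have := width_succ 0
    rw [width_zero] at this
    rw [width_zero, h.top, hK _ (by linarith) le_rfl, (isStair_zigzag 0).top]
  | succ n ih =>
    have h₀ := width_pos (n + 2)
    have h₁ := width_succ (n + 1)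
    have h₂ := width_succ n
    have h₃ := width_le n
    have high := ih fun x hx hx' => by
      rw [hK x (by linarith) hx', zigzag_succ_high n hx]
    -- The inherited constant piece transports the known value at its right end to the next sloped
    -- piece.
    have mid : ∀ x, width (n + 1) ≤ x → x ≤ 2 * width (n + 1) → k x = K x := by
      intro x hx hx'
      have e : K x = K (2 * width (n + 1)) := by
        rw [hK x (by linarith) (by linarith), hK _ (by linarith) (by linarith),
          zigzag_succ_mid n hx hx', zigzag_succ_high n le_rfl]
      rw [h.const x _ (by linarith) hx' (by linarith) e, e]
      exact high _ le_rfl (by linarith)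
    intro x hx hx'
    rcases le_total x (width (n + 1)) with hl | hl
    · exact linear (n + 1) hK (mid _ le_rfl (by linarith)) x hx hl
    rcases le_total x (2 * width (n + 1)) with hl' | hl'
    · exact mid x hl hl'
    · exact high x hl' hx'

/-- Only the segment at the origin remains: there Cauchy's equation holds on all of `[0, width n]`,
and the value at `width n` is already known. -/
lemma Inherits.eq_zigzag {k : ℝ → ℝ} {n : ℕ} (h : Inherits k (zigzag n)) {x : ℝ} (hx : 0 ≤ x)
    (hx' : x ≤ 1 / 4) : k x = zigzag n x := by
  have high := h.eq_of_eq_zigzag n fun _ _ _ => rfl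
  have h₀ := width_pos (n + 1)
  have h₁ := width_succ n
  rcases le_total (2 * width (n + 1)) x with hl | hl
  · exact high x hl hx'
  obtain ⟨M, hM⟩ := h.bounded
  have h₂ := width_le n
  have e := linear_of_additive_of_bounded (ψ := k) (width_pos n)
    (fun y z hy hz hyz => h.additive y z hy hz (by linarith) (by
      rw [zigzag_low n hyz, zigzag_low n (by linarith), zigzag_low n (by linarith)]
      ring))
    (fun y hy hy' => hM y hy (by linarith)) hx (by linarith)
  rw [e, high (width n) (by linarith) h₂, zigzag_low n le_rfl, zigzag_low n (by linarith),
    mul_div_assoc, div_self (width_pos n).ne', mul_one]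

lemma isExtreme_zigzag (n : ℕ) : IsExtreme (1 / 2) intSubgroup (stairLift (zigzag n)) :=
  (isStair_zigzag n).isExtreme fun _ hk _ => hk.eq_zigzag

/-- On the flattened piece constancy is inherited, and the value at its right end is already known;
the origin itself is normalized. -/
lemma isExtreme_flatten_zigzag (n : ℕ) :
    IsExtreme (1 / 2) intSubgroup (stairLift (flatten (zigzag n) (2 * width (n + 1)))) := by
  have h₀ := width_pos (n + 1)
  have h₁ := width_succ n
  have h₂ := width_le n
  refine ((isStair_zigzag n).flatten (by linarith) (by linarith)).isExtreme fun k hk x hx hx' => ?_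
  have high := hk.eq_of_eq_zigzag n fun x hx _ => flatten_high (by linarith) hx
  rcases hx.eq_or_lt with rfl | hx
  · rw [hk.zero, flatten_zero]
  rcases le_total (2 * width (n + 1)) x with hl | hl
  · exact high x hl hx'
  have e : flatten (zigzag n) (2 * width (n + 1)) x
      = flatten (zigzag n) (2 * width (n + 1)) (2 * width (n + 1)) := by
    rw [flatten_low hx hl, flatten_low (by linarith) le_rfl]
  rw [e, ← high _ le_rfl (by linarith)]
  exact hk.const _ _ hx.le hl (by linarith) e

/-- The gradients of `zigzag n`. -/
noncomputable def gradients (n : ℕ) : Finset ℝ :=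
  insert 0 ((Finset.range (n + 1)).image fun j => 4 * 2 ^ j)

lemma zero_mem_gradients (n : ℕ) : (0 : ℝ) ∈ gradients n := Finset.mem_insert_self _ _

lemma pow_mem_gradients {j n : ℕ} (h : j ≤ n) : (4 * 2 ^ j : ℝ) ∈ gradients n :=
  Finset.mem_insert_of_mem (Finset.mem_image.2 ⟨j, Finset.mem_range_succ_iff.2 h, rfl⟩)

lemma gradients_subset_succ (n : ℕ) : gradients n ⊆ gradients (n + 1) :=
  Finset.insert_subset_insert _ (Finset.image_subset_image (Finset.range_mono (by omega)))

lemma card_gradients (n : ℕ) : (gradients n).card = n + 2 := by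
  rw [gradients, Finset.card_insert_of_notMem, Finset.card_image_of_injective, Finset.card_range]
  · intro i j hij
    have : (2 : ℝ) ^ i = 2 ^ j := by simpa using hij
    exact pow_right_injective₀ (by norm_num) (by norm_num) this
  · simp

lemma ncard_image_gradients (n : ℕ) :
    ((fun c : ℝ => c - 2) '' (gradients n : Set ℝ)).ncard = n + 2 := by
  rw [Set.ncard_image_of_injective _ (sub_left_injective), Set.ncard_coe_finset, card_gradients]

lemma rightAffine_zigzag (n : ℕ) (x : ℝ) :
    ∃ c ∈ gradients n, RightAffine (zigzag n) x c (zigzag n x) := by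
  induction n with
  | zero =>
    exact ⟨_, pow_mem_gradients le_rfl, 1, one_pos, fun t _ _ => by simp [zigzag, mul_add]⟩
  | succ n ih =>
    rcases lt_or_ge x (width (n + 1)) with h | h
    · refine ⟨_, pow_mem_gradients le_rfl, _, sub_pos.2 h, fun t ht ht' => ?_⟩
      rw [zigzag_low _ (by linarith), zigzag_low _ h.le, mul_add]
    rcases lt_or_ge x (2 * width (n + 1)) with h' | h'
    · refine ⟨0, zero_mem_gradients _, _, sub_pos.2 h', fun t ht ht' => ?_⟩
      rw [zigzag_succ_mid n (by linarith) (by linarith), zigzag_succ_mid n h h'.le, zero_mul,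
        add_zero]
    · obtain ⟨c, hc, ε, hε, hh⟩ := ih
      refine ⟨c, gradients_subset_succ n hc, ε, hε, fun t ht ht' => ?_⟩
      rw [zigzag_succ_high n (by linarith), zigzag_succ_high n h', hh t ht ht']

lemma leftAffine_zigzag (n : ℕ) (x : ℝ) :
    ∃ c ∈ gradients n, LeftAffine (zigzag n) x c (zigzag n x) := by
  induction n with
  | zero =>
    exact ⟨_, pow_mem_gradients le_rfl, 1, one_pos, fun t _ _ => by simp [zigzag, mul_sub]⟩
  | succ n ih =>
    rcases le_or_gt x (width (n + 1)) with h | h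
    · refine ⟨_, pow_mem_gradients le_rfl, 1, one_pos, fun t ht ht' => ?_⟩
      rw [zigzag_low _ (by linarith), zigzag_low _ h, mul_sub]
    rcases le_or_gt x (2 * width (n + 1)) with h' | h'
    · refine ⟨0, zero_mem_gradients _, _, sub_pos.2 h, fun t ht ht' => ?_⟩
      rw [zigzag_succ_mid n (by linarith) (by linarith), zigzag_succ_mid n h.le h', zero_mul,
        sub_zero]
    · obtain ⟨c, hc, ε, hε, hh⟩ := ih
      refine ⟨c, gradients_subset_succ n hc, min ε (x - 2 * width (n + 1)),
        lt_min hε (by linarith), fun t ht ht' => ?_⟩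
      have := ht'.trans_le (min_le_right _ _)
      rw [zigzag_succ_high n (by linarith), zigzag_succ_high n h'.le,
        hh t ht (ht'.trans_le (min_le_left _ _))]

/-- The gradients of `zigzag n` are attained away from the origin. -/
lemma exists_zigzag_gradient {n : ℕ} {c : ℝ} (hc : c ∈ gradients n) (hc0 : c ≠ 0) :
    ∃ a b, 2 * width (n + 1) ≤ a ∧ a < b ∧ b ≤ 1 / 4 ∧ ∀ x ∈ Ioo a b, zigzag n x = 0 + c * x := by
  obtain ⟨j, hj, rfl⟩ := Finset.mem_image.1 ((Finset.mem_insert.1 hc).resolve_left hc0)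
  have hj := Finset.mem_range_succ_iff.1 hj
  refine ⟨2 * width (j + 1), width j, ?_, ?_, width_le j, fun x hx => ?_⟩
  · linarith [width_anti (Nat.succ_le_succ hj)]
  · linarith [width_succ j, width_pos (j + 1)]
  · rw [zigzag_of_le hj hx.1.le, zigzag_low j hx.2.le, zero_add]

lemma exists_continuous_extreme (n : ℕ) : ∃ (f : ℝ) (π : ℝ → ℝ), f ∉ intSubgroup ∧
    IsExtreme f intSubgroup π ∧ IsContinuousPiecewiseLinear π ∧ (slopes π).ncard = n + 2 := by
  have hR : ∀ x, 0 ≤ x → x < 1 / 4 → ∃ c ∈ (gradients n : Set ℝ), ∃ d,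
      (True → d = zigzag n x) ∧ RightAffine (zigzag n) x c d := fun x _ _ =>
    (rightAffine_zigzag n x).imp fun c h => ⟨h.1, _, fun _ => rfl, h.2⟩
  have hL : ∀ x, 0 < x → x ≤ 1 / 4 → ∃ c ∈ (gradients n : Set ℝ), ∃ d,
      (True → d = zigzag n x) ∧ LeftAffine (zigzag n) x c d := fun x _ _ =>
    (leftAffine_zigzag n x).imp fun c h => ⟨h.1, _, fun _ => rfl, h.2⟩
  have h0 : (0 : ℝ) ∈ (gradients n : Set ℝ) := zero_mem_gradients n
  have hK := isStair_zigzag n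
  refine ⟨1 / 2, stairLift (zigzag n), half_notMem_intSubgroup, isExtreme_zigzag n,
    isContinuousPiecewiseLinear_of_right_left (fun x => ?_) (fun x => ?_), ?_⟩
  · obtain ⟨c, -, d, hd, h⟩ := hK.rightAffine_stairLift h0 hR hL x
    exact ⟨_, hd trivial ▸ h⟩
  · obtain ⟨c, -, d, hd, h⟩ := hK.leftAffine_stairLift h0 hR hL x
    exact ⟨_, hd trivial ▸ h⟩
  · rw [hK.slopes_stairLift h0 hR hL, ncard_image_gradients]
    intro c hc hc0
    obtain ⟨a, b, ha, hab, hb, h⟩ := exists_zigzag_gradient hc hc0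
    exact ⟨a, b, 0, by linarith [width_pos (n + 1)], hab, hb, h⟩

lemma exists_discontinuous_extreme (n : ℕ) : ∃ (f : ℝ) (π : ℝ → ℝ), f ∉ intSubgroup ∧
    IsExtreme f intSubgroup π ∧ IsPiecewiseLinear π ∧ ¬ Continuous π ∧
    (slopes π).ncard = n + 2 := by
  have h₀ := width_pos (n + 1)
  have h₁ := width_succ n
  have h₂ := width_le n
  set e := 2 * width (n + 1) with he
  have he0 : 0 < e := by linarith
  have hK : IsStair (flatten (zigzag n) e) := (isStair_zigzag n).flatten he0 (by linarith)
  have hR : ∀ x, 0 ≤ x → x < 1 / 4 → ∃ c ∈ (gradients n : Set ℝ), ∃ d,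
      (False → d = flatten (zigzag n) e x) ∧ RightAffine (flatten (zigzag n) e) x c d := by
    intro x hx _
    rcases lt_or_ge x e with h | h
    · refine ⟨0, zero_mem_gradients n, zigzag n e, False.elim, e - x, sub_pos.2 h,
        fun t ht ht' => ?_⟩
      rw [flatten_low (by linarith) (by linarith), zero_mul, add_zero]
    · obtain ⟨c, hc, ε, hε, hh⟩ := rightAffine_zigzag n x
      refine ⟨c, hc, zigzag n x, False.elim, ε, hε, fun t ht ht' => ?_⟩
      rw [flatten_high he0 (by linarith), hh t ht ht']
  have hL : ∀ x, 0 < x → x ≤ 1 / 4 → ∃ c ∈ (gradients n : Set ℝ), ∃ d,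
      (False → d = flatten (zigzag n) e x) ∧ LeftAffine (flatten (zigzag n) e) x c d := by
    intro x hx _
    rcases le_or_gt x e with h | h
    · refine ⟨0, zero_mem_gradients n, zigzag n e, False.elim, x, hx, fun t ht ht' => ?_⟩
      rw [flatten_low (by linarith) (by linarith), zero_mul, sub_zero]
    · obtain ⟨c, hc, ε, hε, hh⟩ := leftAffine_zigzag n x
      refine ⟨c, hc, zigzag n x, False.elim, min ε (x - e), lt_min hε (by linarith), fun t ht ht' => ?_⟩
      have := ht'.trans_le (min_le_right _ _)
      rw [flatten_high he0 (by linarith), hh t ht (ht'.trans_le (min_le_left _ _))]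
  have h0 : (0 : ℝ) ∈ (gradients n : Set ℝ) := zero_mem_gradients n
  refine ⟨1 / 2, stairLift (flatten (zigzag n) e), half_notMem_intSubgroup,
    isExtreme_flatten_zigzag n, isPiecewiseLinear_of_right_left (fun x => ?_) (fun x => ?_), ?_, ?_⟩
  · obtain ⟨c, -, d, -, h⟩ := hK.rightAffine_stairLift h0 hR hL x
    exact ⟨_, d, h⟩
  · obtain ⟨c, -, d, -, h⟩ := hK.leftAffine_stairLift h0 hR hL x
    exact ⟨_, d, h⟩
  · intro hcont
    have hr : RightAffine (stairLift (flatten (zigzag n) e)) 0 (-2) (zigzag n e) := by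
      refine ⟨e, he0, fun t ht ht' => ?_⟩
      rw [zero_add, hK.stairLift_low ht.le (by linarith), flatten_low ht ht'.le]
      ring
    refine hr.not_continuousWithinAt ?_ hcont.continuousWithinAt
    rw [hK.isMinimal.zero]
    have := (isStair_zigzag n).four_mul_le he0.le (by linarith)
    linarith
  -- Flattening loses no gradient, as each nonzero one occurs to the right of `e`.
  · rw [hK.slopes_stairLift h0 hR hL, ncard_image_gradients]
    intro c hc hc0
    obtain ⟨a, b, ha, hab, hb, h⟩ := exists_zigzag_gradient hc hc0
    refine ⟨a, b, 0, by linarith, hab, hb, fun x hx => ?_⟩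
    rw [flatten_high he0 (by linarith [hx.1]), h x hx]

/-! ### A function discontinuous on both sides at the origin -/

/-- A discontinuous function on `[0, 1/2]` with all its gradients equal to `-1`. -/
noncomputable def spike (t : ℝ) : ℝ :=
  if t = 0 then 0 else if t < 1 / 4 then 1 / 2 - t else if t = 1 / 4 then 1 / 2
    else if t < 1 / 2 then 1 - t else 1

/-- The function `spike` of the distance to the nearest integer. -/
noncomputable def spikes (x : ℝ) : ℝ := spike |x - round x|

lemma spike_low {t : ℝ} (h₀ : 0 < t) (h₁ : t < 1 / 4) : spike t = 1 / 2 - t := by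
  rw [spike, if_neg h₀.ne', if_pos h₁]

lemma spike_high {t : ℝ} (h₀ : 1 / 4 < t) (h₁ : t < 1 / 2) : spike t = 1 - t := by
  rw [spike, if_neg (by linarith), if_neg h₀.not_gt, if_neg h₀.ne', if_pos h₁]

lemma spike_zero : spike 0 = 0 := if_pos rfl

lemma spike_quarter : spike (1 / 4) = 1 / 2 := by norm_num [spike]

lemma spike_half : spike (1 / 2) = 1 := by norm_num [spike]

lemma spike_cases {t : ℝ} (h₀ : 0 ≤ t) (h₁ : t ≤ 1 / 2) :
    (t = 0 ∧ spike t = 0) ∨ (0 < t ∧ t < 1 / 4 ∧ spike t = 1 / 2 - t) ∨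
      (t = 1 / 4 ∧ spike t = 1 / 2) ∨ (1 / 4 < t ∧ t < 1 / 2 ∧ spike t = 1 - t) ∨
      (t = 1 / 2 ∧ spike t = 1) := by
  rcases h₀.eq_or_lt with rfl | h₀
  · exact Or.inl ⟨rfl, spike_zero⟩
  rcases lt_trichotomy t (1 / 4) with h | rfl | h
  · exact Or.inr (Or.inl ⟨h₀, h, spike_low h₀ h⟩)
  · exact Or.inr (Or.inr (Or.inl ⟨rfl, spike_quarter⟩))
  rcases h₁.eq_or_lt with rfl | h₁
  · exact Or.inr (Or.inr (Or.inr (Or.inr ⟨rfl, spike_half⟩)))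
  · exact Or.inr (Or.inr (Or.inr (Or.inl ⟨h, h₁, spike_high h h₁⟩)))

lemma spike_nonneg {t : ℝ} (h₀ : 0 ≤ t) (h₁ : t ≤ 1 / 2) : 0 ≤ spike t := by
  rcases spike_cases h₀ h₁ with h | h | h | h | h <;> linarith

lemma spike_symm {t : ℝ} (h₀ : 0 ≤ t) (h₁ : t ≤ 1 / 2) : spike t + spike (1 / 2 - t) = 1 := by
  rcases spike_cases h₀ h₁ with h | h | h | h | h <;>
  rcases spike_cases (t := 1 / 2 - t) (by linarith) (by linarith) with h' | h' | h' | h' | h' <;>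
  linarith

/-- If `a + b + c = 1/2`, then the values of `spike` at `a`, `b`, `c` have sum at least `1`. -/
lemma spike_triple {a b c : ℝ} (ha : 0 ≤ a) (hb : 0 ≤ b) (hc : 0 ≤ c) (h : a + b + c = 1 / 2) :
    1 ≤ spike a + spike b + spike c := by
  rcases spike_cases ha (by linarith) with h₁ | h₁ | h₁ | h₁ | h₁ <;>
  rcases spike_cases hb (by linarith) with h₂ | h₂ | h₂ | h₂ | h₂ <;>
  rcases spike_cases hc (by linarith) with h₃ | h₃ | h₃ | h₃ | h₃ <;>
  linarith

/-- The same if `a = 1/2 + b - c` or the like. -/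
lemma spike_triple' {a b c : ℝ} (ha : 0 ≤ a) (ha' : a ≤ 1 / 2) (hb : 0 ≤ b) (hb' : b ≤ 1 / 2)
    (hc : 0 ≤ c) (hc' : c ≤ 1 / 2) (h : a + b - c = 1 / 2) :
    1 ≤ spike a + spike b + spike c := by
  rcases spike_cases ha ha' with h₁ | h₁ | h₁ | h₁ | h₁ <;>
  rcases spike_cases hb hb' with h₂ | h₂ | h₂ | h₂ | h₂ <;>
  rcases spike_cases hc hc' with h₃ | h₃ | h₃ | h₃ | h₃ <;>
  linarith

lemma spikes_add_int (x : ℝ) (k : ℤ) : spikes (x + k) = spikes x := by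
  rw [spikes, round_add_intCast, Int.cast_add, add_sub_add_right_eq_sub, spikes]

lemma spikes_eq {x : ℝ} (h : |x| ≤ 1 / 2) : spikes x = spike |x| := by
  obtain ⟨h₀, h₁⟩ := abs_le.1 h
  rcases h₁.eq_or_lt with rfl | h₁
  · rw [spikes, round_eq, add_halves, Int.floor_one, Int.cast_one, abs_sub_comm]
    norm_num
  · have : round x = 0 := by
      rw [round_eq]
      exact Int.floor_eq_zero_iff.2 ⟨by linarith, by linarith⟩
    rw [spikes, this, Int.cast_zero, sub_zero]

lemma spikes_symm {x : ℝ} (h₀ : -(1 / 2) ≤ x) (h₁ : x ≤ 1 / 2) :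
    spikes x + spikes (1 / 2 - x) = 1 := by
  rcases le_total 0 x with h | h
  · rw [spikes_eq (abs_le.2 ⟨h₀, h₁⟩), spikes_eq (abs_le.2 ⟨by linarith, by linarith⟩),
      abs_of_nonneg h, abs_of_nonneg (by linarith)]
    exact spike_symm h h₁
  · have e : 1 / 2 - x = -(1 / 2 + x) + (1 : ℤ) := by push_cast; ring
    rw [e, spikes_add_int, spikes_eq (abs_le.2 ⟨h₀, h₁⟩),
      spikes_eq (abs_le.2 ⟨by linarith, by linarith⟩), abs_of_nonpos h, abs_neg,
      abs_of_nonneg (by linarith)]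
    have := spike_symm (t := -x) (by linarith) (by linarith)
    rwa [sub_neg_eq_add] at this

/-- By symmetry, subadditivity says that the values at `x`, `y` and `1/2 - (x + y)` sum to at least
`1`. In terms of distances to the nearest integers, the signs of `x`, `y` and `x + y` lead to one of
the two triple inequalities. -/
lemma spikes_subadd {x y : ℝ} (hx : |x| ≤ 1 / 2) (hy : |y| ≤ 1 / 2) :
    spikes (x + y) ≤ spikes x + spikes y := by
  obtain ⟨hx₀, hx₁⟩ := abs_le.1 hx
  obtain ⟨hy₀, hy₁⟩ := abs_le.1 hy
  rw [spikes_eq hx, spikes_eq hy]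
  have key : ∀ s, 0 ≤ s → s ≤ 1 / 2 → 1 ≤ spike |x| + spike |y| + spike (1 / 2 - s) →
      spike s ≤ spike |x| + spike |y| := fun s h₀ h₁ h => by linarith [spike_symm h₀ h₁]
  rcases le_total 0 x with hx' | hx' <;> rcases le_total 0 y with hy' | hy'
  · rw [abs_of_nonneg hx', abs_of_nonneg hy'] at *
    rcases le_total (x + y) (1 / 2) with h | h
    · rw [spikes_eq (abs_le.2 ⟨by linarith, h⟩), abs_of_nonneg (by linarith)]
      exact key _ (by linarith) h (spike_triple hx' hy' (by linarith) (by ring))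
    · rw [← spikes_add_int _ (-1), spikes_eq (abs_le.2 ⟨by push_cast; linarith, by
        push_cast; linarith⟩), abs_of_nonpos (by push_cast; linarith)]
      push_cast
      exact key _ (by linarith) (by linarith) (spike_triple' hx' hx₁ hy' hy₁ (by linarith)
        (by linarith) (by ring))
  · rw [abs_of_nonneg hx', abs_of_nonpos hy'] at *
    rw [spikes_eq (abs_le.2 ⟨by linarith, by linarith⟩)]
    rcases le_total 0 (x + y) with h | h
    · rw [abs_of_nonneg h]
      refine key _ h (by linarith) ?_
      linarith [spike_triple' (a := 1 / 2 - (x + y)) (b := x) (c := -y) (by linarith) (by linarith)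
        hx' hx₁ (by linarith) hy (by ring)]
    · rw [abs_of_nonpos h]
      refine key _ (by linarith) (by linarith) ?_
      linarith [spike_triple' (a := 1 / 2 - -(x + y)) (b := -y) (c := x) (by linarith)
        (by linarith) (by linarith) hy hx' hx₁ (by ring)]
  · rw [abs_of_nonpos hx', abs_of_nonneg hy'] at *
    rw [spikes_eq (abs_le.2 ⟨by linarith, by linarith⟩)]
    rcases le_total 0 (x + y) with h | h
    · rw [abs_of_nonneg h]
      refine key _ h (by linarith) ?_
      linarith [spike_triple' (a := 1 / 2 - (x + y)) (b := y) (c := -x) (by linarith) (by linarith)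
        hy' hy₁ (by linarith) hx (by ring)]
    · rw [abs_of_nonpos h]
      refine key _ (by linarith) (by linarith) ?_
      linarith [spike_triple' (a := 1 / 2 - -(x + y)) (b := -x) (c := y) (by linarith)
        (by linarith) (by linarith) hx hy' hy₁ (by ring)]
  · rw [abs_of_nonpos hx', abs_of_nonpos hy'] at *
    rcases le_total (-(1 / 2)) (x + y) with h | h
    · rw [spikes_eq (abs_le.2 ⟨h, by linarith⟩), abs_of_nonpos (by linarith)]
      exact key _ (by linarith) (by linarith)
        (spike_triple (by linarith) (by linarith) (by linarith) (by ring))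
    · rw [← spikes_add_int _ 1, spikes_eq (abs_le.2 ⟨by push_cast; linarith, by
        push_cast; linarith⟩), abs_of_nonneg (by push_cast; linarith)]
      push_cast
      exact key _ (by linarith) (by linarith) (spike_triple' (by linarith) hx (by linarith) hy
        (by linarith) (by linarith) (by ring))

/-- Recentred at `x = y = z = 1/6`, the relation reads `ψ r + ψ s + ψ t = 0` for `r + s + t = 0` in
`(-1/6, 1/12)`. Hence `ψ` is odd and additive near `0`, and `ψ t = -2 ψ (-t/2)` extends linearity to
the whole asymmetric interval. -/
lemma affine_of_triple {g : ℝ → ℝ} {M : ℝ} (hM : ∀ x, |g x| ≤ M)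
    (h : ∀ x y z, 0 < x → x < 1 / 4 → 0 < y → y < 1 / 4 → 0 < z → z < 1 / 4 → x + y + z = 1 / 2 →
      g x + g y + g z = 1) :
    ∃ c, ∀ x, 0 < x → x < 1 / 4 → g x = 1 / 3 + c * (x - 1 / 6) := by
  set ψ : ℝ → ℝ := fun t => g (1 / 6 + t) - 1 / 3 with hψ
  have triple : ∀ r s t, -(1 / 6) < r → r < 1 / 12 → -(1 / 6) < s → s < 1 / 12 → -(1 / 6) < t →
      t < 1 / 12 → r + s + t = 0 → ψ r + ψ s + ψ t = 0 := by
    intro r s t hr hr' hs hs' ht ht' hrst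
    have := h (1 / 6 + r) (1 / 6 + s) (1 / 6 + t) (by linarith) (by linarith) (by linarith)
      (by linarith) (by linarith) (by linarith) (by linarith)
    simp only [hψ]
    linarith
  have zero : ψ 0 = 0 := by
    have := triple 0 0 0 (by norm_num) (by norm_num) (by norm_num) (by norm_num) (by norm_num)
      (by norm_num) (by norm_num)
    linarith
  have double : ∀ t, -(1 / 6) < t → t < 1 / 12 → ψ t = -2 * ψ (-(t / 2)) := by
    intro t ht ht'
    have := triple t (-(t / 2)) (-(t / 2)) ht ht' (by linarith) (by linarith) (by linarith)
      (by linarith) (by ring)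
    linarith
  have odd : ∀ t, -(1 / 12) < t → t < 1 / 12 → ψ (-t) = -ψ t := by
    intro t ht ht'
    have := triple t (-t) 0 (by linarith) ht' (by linarith) (by linarith) (by norm_num)
      (by norm_num) (by ring)
    linarith
  -- Any endpoint in `[1/24, 1/12)` would serve: closed, within the range of oddness, and reaching
  -- half of `1/12`.
  have base : ∀ t, 0 ≤ t → t ≤ 1 / 16 → ψ t = ψ (1 / 16) / (1 / 16) * t := by
    intro t ht ht'
    refine linear_of_additive_of_bounded (M := M + 1 / 3) (by norm_num) (fun r s hr hs hrs => ?_)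
      (fun s _ _ => ?_) ht ht'
    · have e₁ := triple r s (-(r + s)) (by linarith) (by linarith) (by linarith) (by linarith)
        (by linarith) (by linarith) (by ring)
      rw [odd (r + s) (by linarith) (by linarith)] at e₁
      linarith
    · have := abs_sub (g (1 / 6 + s)) (1 / 3)
      rw [abs_of_pos (show (0 : ℝ) < 1 / 3 by norm_num)] at this
      linarith [hM (1 / 6 + s)]
  have pos : ∀ t, 0 ≤ t → t < 1 / 12 → ψ t = ψ (1 / 16) / (1 / 16) * t := by
    intro t ht ht'
    rw [double t (by linarith) ht', odd _ (by linarith) (by linarith),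
      base (t / 2) (by linarith) (by linarith)]
    ring
  refine ⟨ψ (1 / 16) / (1 / 16), fun x hx hx' => ?_⟩
  have hx₁ : ψ (x - 1 / 6) = ψ (1 / 16) / (1 / 16) * (x - 1 / 6) := by
    rcases le_total 0 (x - 1 / 6) with h₀ | h₀
    · exact pos _ h₀ (by linarith)
    · rw [double _ (by linarith) (by linarith), pos _ (by linarith) (by linarith)]
      ring
  rw [← hx₁]
  simp only [hψ, add_sub_cancel]

lemma nonneg_of_forall_mul_le {A B : ℝ} (h : ∀ ε, 0 < ε → ε < 1 / 8 → B * ε ≤ A) : 0 ≤ A := by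
  have ht : Tendsto (fun ε => B * ε) (𝓝[>] 0) (𝓝 (B * 0)) :=
    ((continuous_const.mul continuous_id).tendsto 0).mono_left nhdsWithin_le_nhds
  rw [mul_zero] at ht
  refine le_of_tendsto ht ?_
  filter_upwards [Ioo_mem_nhdsGT (show (0 : ℝ) < 1 / 8 by norm_num)] with ε hε
  exact h ε hε.1 hε.2

lemma isMinimal_spikes : IsMinimal (1 / 2) spikes :=
  isMinimal_half spikes_add_int (by rw [spikes_eq (by norm_num), abs_zero, spike_zero])
    (fun x h₀ h₁ => by
      have h := abs_le.2 ⟨h₀, h₁⟩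
      rw [spikes_eq h]
      exact spike_nonneg (abs_nonneg x) h)
    (fun _ => spikes_symm)
    (fun _ _ h₀ h₁ h₂ h₃ => spikes_subadd (abs_le.2 ⟨h₀, h₁⟩) (abs_le.2 ⟨h₂, h₃⟩))

lemma spikes_low {x : ℝ} (h₀ : 0 < x) (h₁ : x < 1 / 4) : spikes x = 1 / 2 - x := by
  rw [spikes_eq (abs_le.2 ⟨by linarith, by linarith⟩), abs_of_pos h₀, spike_low h₀ h₁]

lemma spikes_high {x : ℝ} (h₀ : 1 / 4 < x) (h₁ : x < 1 / 2) : spikes x = 1 - x := by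
  rw [spikes_eq (abs_le.2 ⟨by linarith, by linarith⟩), abs_of_pos (by linarith), spike_high h₀ h₁]

lemma spikes_neg_low {x : ℝ} (h₀ : 0 < x) (h₁ : x < 1 / 4) : spikes (-x) = 1 / 2 - x := by
  rw [spikes_eq (abs_le.2 ⟨by linarith, by linarith⟩), abs_neg, abs_of_pos h₀, spike_low h₀ h₁]

lemma spikes_neg_high {x : ℝ} (h₀ : 1 / 4 < x) (h₁ : x < 1 / 2) : spikes (-x) = 1 - x := by
  rw [spikes_eq (abs_le.2 ⟨by linarith, by linarith⟩), abs_neg, abs_of_pos (by linarith),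
    spike_high h₀ h₁]

lemma IsMinimal.apply_quarter {g : ℝ → ℝ} (hg : IsMinimal (1 / 2) g) : g (1 / 4) = 1 / 2 := by
  have := hg.symm (1 / 4)
  norm_num at this
  linarith

lemma IsMinimal.symm_neg {g : ℝ → ℝ} (hg : IsMinimal (1 / 2) g) (x : ℝ) :
    g x + g (-(1 / 2) - x) = 1 := by
  have := hg.symm x
  rwa [show 1 / 2 - x = -(1 / 2) - x + 1 by ring, hg.periodic] at this

lemma IsMinimal.apply_neg_quarter {g : ℝ → ℝ} (hg : IsMinimal (1 / 2) g) :
    g (-(1 / 4)) = 1 / 2 := by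
  have := hg.symm_neg (-(1 / 4))
  norm_num at this
  linarith

/-- The triples in `(0, 1/4)` summing to `1/2`, and their negatives, are additive for `spikes`; they
leave only the gradients `c`, `c'` on the two sides of the origin. Subadditivity across the jumps
bounds these. -/
lemma isExtreme_spikes : IsExtreme (1 / 2) intSubgroup spikes := by
  have affine : ∀ g g', IsMinimal (1 / 2) g → IsMinimal (1 / 2) g' →
      (∀ x, spikes x = (g x + g' x) / 2) → ∃ c c',
      (∀ x, 0 < x → x < 1 / 4 → g x = 1 / 3 + c * (x - 1 / 6)) ∧
      (∀ x, 0 < x → x < 1 / 4 → g (-x) = 1 / 3 + c' * (x - 1 / 6)) ∧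
      0 ≤ 1 / 3 + c / 4 + c' / 12 ∧ 0 ≤ 1 / 3 + c' / 4 + c / 12 := by
    intro g g' hg hg' havg
    have hadd {x y : ℝ} := additive_of_average hg hg' havg (x := x) (y := y)
    have hM : ∀ x, |g x| ≤ 1 := fun x => abs_le.2 ⟨by linarith [hg.nonneg x], hg.le_one x⟩
    obtain ⟨c, hc⟩ := affine_of_triple hM fun x y z hx hx' hy hy' hz hz' h => by
      have e := hadd (x := x) (y := y) (by
        rw [spikes_high (by linarith) (by linarith), spikes_low hx hx', spikes_low hy hy']
        ring)
      have e' := hg.symm (x + y)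
      rw [show 1 / 2 - (x + y) = z by linarith] at e'
      linarith
    obtain ⟨c', hc'⟩ := affine_of_triple (g := fun x => g (-x)) (fun x => hM (-x))
      fun x y z hx hx' hy hy' hz hz' h => by
      have e := hadd (x := -x) (y := -y) (by
        rw [← neg_add, spikes_neg_high (by linarith) (by linarith), spikes_neg_low hx hx',
          spikes_neg_low hy hy']
        ring)
      have e' := hg.symm_neg (-x + -y)
      rw [show -(1 / 2) - (-x + -y) = -z by linarith] at e'
      linarith
    -- In the limit `ε → 0`, the first inequality compares the right limit at `0` with the sum of
    -- the left limit at `1/4` and the right limit at `-1/4`; the second is its mirror image.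
    refine ⟨c, c', hc, hc', nonneg_of_forall_mul_le (B := 2 * c + 2 * c') fun ε hε hε' => ?_,
      nonneg_of_forall_mul_le (B := 2 * c + 2 * c') fun ε hε hε' => ?_⟩
    · have e := hg.subadd (1 / 4 - ε) (-(1 / 4 - 2 * ε))
      rw [show 1 / 4 - ε + -(1 / 4 - 2 * ε) = ε by ring, hc ε hε (by linarith),
        hc _ (by linarith) (by linarith), hc' _ (by linarith) (by linarith)] at e
      linarith
    · have e := hg.subadd (-(1 / 4 - ε)) (1 / 4 - 2 * ε)
      rw [show -(1 / 4 - ε) + (1 / 4 - 2 * ε) = -ε by ring, hc' ε hε (by linarith),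
        hc' (1 / 4 - ε) (by linarith) (by linarith), hc _ (by linarith) (by linarith)] at e
      linarith
  refine isMinimal_spikes.isExtreme fun g g' hg hg' havg => ?_
  obtain ⟨c, c', hc, hc', h₁, h₂⟩ := affine g g' hg hg' havg
  obtain ⟨d, d', hd, hd', h₃, h₄⟩ := affine g' g hg' hg fun x => by rw [havg, add_comm]
  have hcd : c + d = -2 := by
    have := havg (1 / 8)
    rw [spikes_low (by norm_num) (by norm_num), hc _ (by norm_num) (by norm_num),
      hd _ (by norm_num) (by norm_num)] at this
    linarith
  have hcd' : c' + d' = -2 := by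
    have := havg (-(1 / 8))
    rw [spikes_neg_low (by norm_num) (by norm_num), hc' _ (by norm_num) (by norm_num),
      hd' _ (by norm_num) (by norm_num)] at this
    linarith
  -- The inequalities for `g` and `g'` add up to equalities because the gradients average to `-1`.
  -- Hence all are tight, and the two resulting linear equations have only the solution `c = c' =
  -- -1`.
  obtain rfl : c = -1 := by linarith
  obtain rfl : c' = -1 := by linarith
  have central : ∀ x, -(1 / 4) ≤ x → x ≤ 1 / 4 → g x = spikes x := by
    intro x h₀ h₁
    rcases lt_trichotomy x 0 with hx | rfl | hx
    · rcases h₀.eq_or_lt with rfl | h₀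
      · rw [hg.apply_neg_quarter, isMinimal_spikes.apply_neg_quarter]
      · have e₁ := hc' (-x) (by linarith) (by linarith)
        have e₂ := spikes_neg_low (x := -x) (by linarith) (by linarith)
        rw [neg_neg] at e₁ e₂
        rw [e₁, e₂]
        ring
    · rw [hg.zero, isMinimal_spikes.zero]
    · rcases h₁.eq_or_lt with rfl | h₁
      · rw [hg.apply_quarter, isMinimal_spikes.apply_quarter]
      · rw [hc x hx h₁, spikes_low hx h₁]
        ring
  intro x
  obtain ⟨u, k, h₀, h₁, rfl⟩ := exists_eq_add_int x
  rw [hg.periodic_int, spikes_add_int]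
  rcases lt_or_ge u (-(1 / 4)) with h | h
  · linarith [hg.symm_neg u, isMinimal_spikes.symm_neg u,
      central (-(1 / 2) - u) (by linarith) (by linarith)]
  rcases le_or_gt u (1 / 4) with h' | h'
  · exact central u h h'
  · linarith [hg.symm u, isMinimal_spikes.symm u, central (1 / 2 - u) (by linarith) (by linarith)]

lemma rightAffine_spikes_zero : RightAffine spikes 0 (-1) (1 / 2) :=
  ⟨1 / 4, by norm_num, fun t ht ht' => by rw [zero_add, spikes_low ht ht']; ring⟩

lemma leftAffine_spikes_zero : LeftAffine spikes 0 1 (1 / 2) :=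
  ⟨1 / 4, by norm_num, fun t ht ht' => by rw [zero_sub, spikes_neg_low ht ht']; ring⟩

lemma rightAffine_spikes (x : ℝ) : ∃ c d, RightAffine spikes x c d := by
  obtain ⟨u, k, h₀, h₁, rfl⟩ := exists_eq_add_int x
  suffices ∃ c d, RightAffine spikes u c d by
    obtain ⟨c, d, h⟩ := this
    exact ⟨c, d, h.add_int spikes_add_int k⟩
  rcases lt_or_ge u (-(1 / 4)) with h | h
  · refine ⟨1, 1 + u, -(1 / 4) - u, by linarith, fun t ht ht' => ?_⟩
    rw [← neg_neg (u + t), spikes_neg_high (by linarith) (by linarith)]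
    ring
  rcases lt_or_ge u 0 with h' | h'
  · refine ⟨1, 1 / 2 + u, -u, by linarith, fun t ht ht' => ?_⟩
    rw [← neg_neg (u + t), spikes_neg_low (by linarith) (by linarith)]
    ring
  rcases lt_or_ge u (1 / 4) with h'' | h''
  · refine ⟨-1, 1 / 2 - u, 1 / 4 - u, by linarith, fun t ht ht' => ?_⟩
    rw [spikes_low (by linarith) (by linarith)]
    ring
  · refine ⟨-1, 1 - u, 1 / 2 - u, by linarith, fun t ht ht' => ?_⟩
    rw [spikes_high (by linarith) (by linarith)]
    ring

lemma leftAffine_spikes (x : ℝ) : ∃ c d, LeftAffine spikes x c d := by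
  obtain ⟨c, d, h⟩ := rightAffine_spikes (1 / 2 - x)
  exact ⟨c, _, h.left_of_symm isMinimal_spikes.symm⟩

end GroupProblem

theorem mainTheorem6 :
    (∀ s ∈ ({5, 6, 7, 28} : Set ℕ), ∃ (f : ℝ) (π : ℝ → ℝ), f ∉ GroupProblem.intSubgroup ∧
      GroupProblem.IsExtreme f GroupProblem.intSubgroup π ∧
      GroupProblem.IsContinuousPiecewiseLinear π ∧
      (GroupProblem.slopes π).ncard = s) ∧
    (∃ (f : ℝ) (π : ℝ → ℝ), f ∉ GroupProblem.intSubgroup ∧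
      GroupProblem.IsExtreme f GroupProblem.intSubgroup π ∧
      GroupProblem.IsPiecewiseLinear π ∧ ¬ Continuous π ∧
      (GroupProblem.slopes π).ncard = 3) ∧
    (∃ (f : ℝ) (π : ℝ → ℝ), f ∉ GroupProblem.intSubgroup ∧
      GroupProblem.IsExtreme f GroupProblem.intSubgroup π ∧
      GroupProblem.IsPiecewiseLinear π ∧
      ¬ ContinuousWithinAt π (Set.Iio 0) 0 ∧ ¬ ContinuousWithinAt π (Set.Ioi 0) 0) := by
  refine ⟨?_, GroupProblem.exists_discontinuous_extreme 1, 1 / 2, GroupProblem.spikes,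
    GroupProblem.half_notMem_intSubgroup, GroupProblem.isExtreme_spikes,
    GroupProblem.isPiecewiseLinear_of_right_left GroupProblem.rightAffine_spikes
      GroupProblem.leftAffine_spikes,
    GroupProblem.leftAffine_spikes_zero.not_continuousWithinAt ?_,
    GroupProblem.rightAffine_spikes_zero.not_continuousWithinAt ?_⟩
  -- The staircase with `n` constant pieces yields `n + 2` slopes, so `n = s - 2`.
  · rintro s (rfl | rfl | rfl | rfl)
    · exact GroupProblem.exists_continuous_extreme 3
    · exact GroupProblem.exists_continuous_extreme 4
    · exact GroupProblem.exists_continuous_extreme 5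
    · exact GroupProblem.exists_continuous_extreme 26
  · norm_num [GroupProblem.isMinimal_spikes.zero]
  · norm_num [GroupProblem.isMinimal_spikes.zero]
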